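/- Let $G$ be a finite simple $2$-connected graph and let $L$ be a longest cycle of $G$. An $L$-bridge of $G$ is either (i) an edge of $E(G)\setminus E(L)$ with both endpoints in $V(L)$, or (ii) a subgraph consisting of a component $D$ of $G-V(L)$ together with all edges between $V(D)$ and $V(L)$ (and the endpoints of these edges). The attachments of an $L$-bridge $B$ are the vertices in $V(L)\cap V(B)$. The length $\lambda(B)$ is the maximum number of edges of a tree contained in $B$ whose leaves are exactly the attachments of $B$. Two distinct $L$-bridges $B, B'$ overlap if $L$ cannot be partitioned into two edge-disjoint subpaths $P$ and $P'$ (with common ends) such that all attachments of $B$ lie on $P$ and all attachments of $B'$ lie on $P'$. The overlap graph $O_G(L)$ has the $L$-bridges as its vertices, two of them being adjacent if and only if they overlap. Let $k$ be a positive integer and let $B_1,\dots,B_k$ be pairwise vertex-disjoint $L$-bridges that induce a tree in $O_G(L)$. Then $$\sum_{i=1}^{k}\lambda(B_i)\;\le\;\left\lfloor \frac{|E(L)|}{2}\right\rfloor .$$ -/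

import Mathlib

namespace BridgesOfCycles

variable {V : Type*} {G : SimpleGraph V}

/-- A graph is `2`-connected if it has more than two vertices, is connected, and stays connected
after the deletion of any one vertex. -/
def IsTwoConnected (G : SimpleGraph V) : Prop :=
  2 < Nat.card V ∧ G.Connected ∧ ∀ v : V, (G.induce {v}ᶜ).Connected

/-- A cycle (given by a closed walk running once around it) that is at least as long as every
cycle of the graph. -/
def IsLongestCycle {u : V} (L : G.Walk u u) : Prop :=
  L.IsCycle ∧ ∀ (v : V) (C : G.Walk v v), C.IsCycle → C.length ≤ L.length

/-- The vertex set, as a set of vertices of `G`, of a component `D` of `G - V(H)`. -/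
def componentVerts (H : G.Subgraph) (D : (G.induce H.vertsᶜ).ConnectedComponent) : Set V :=
  Subtype.val '' D.supp

/-- The subgraph of `G` consisting of a component `D` of `G - V(H)` together with all edges
between `V(D)` and `V(H)` (and the endpoints of these edges). -/
def componentBridge (H : G.Subgraph) (D : (G.induce H.vertsᶜ).ConnectedComponent) :
    G.Subgraph where
  verts := componentVerts H D ∪ {v | v ∈ H.verts ∧ ∃ d ∈ componentVerts H D, G.Adj d v}
  Adj a b := G.Adj a b ∧
    ((a ∈ componentVerts H D ∧ b ∈ componentVerts H D) ∨
     (a ∈ componentVerts H D ∧ b ∈ H.verts) ∨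
     (a ∈ H.verts ∧ b ∈ componentVerts H D))
  adj_sub h := h.1
  edge_vert := by
    rintro a b ⟨hab, h | h | h⟩
    · exact Or.inl h.1
    · exact Or.inl h.1
    · exact Or.inr ⟨h.1, b, h.2, hab.symm⟩
  symm := ⟨by
    rintro a b ⟨hab, h⟩
    exact ⟨hab.symm, by tauto⟩⟩

/-- `B` is an `H`-bridge of `G`: either a single edge of `G` that is not in `H` but has both
endpoints in `V(H)`, or a component of `G - V(H)` with all edges joining it to `V(H)`. -/
def IsBridgeOf (H B : G.Subgraph) : Prop :=
  (∃ (u v : V) (h : G.Adj u v),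
    u ∈ H.verts ∧ v ∈ H.verts ∧ ¬ H.Adj u v ∧ B = G.subgraphOfAdj h) ∨
  ∃ D : (G.induce H.vertsᶜ).ConnectedComponent, B = componentBridge H D

/-- The type of all `H`-bridges of `G`. -/
abbrev BridgeOf (H : G.Subgraph) : Type _ := {B : G.Subgraph // IsBridgeOf H B}

/-- The attachments of an `H`-bridge `B`: the vertices of `V(H) ∩ V(B)`. -/
def attachments (H B : G.Subgraph) : Set V := H.verts ∩ B.verts

/-- The leaves of a subgraph: its vertices of degree one. -/
def leaves (T : G.Subgraph) : Set V := {v | v ∈ T.verts ∧ (T.neighborSet v).ncard = 1}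

/-- The numbers of edges of the trees in `B` whose leaves are exactly the attachments of `B`. -/
def attachmentTreeSizes (H B : G.Subgraph) : Set ℕ :=
  {n | ∃ T : G.Subgraph, T ≤ B ∧ T.coe.IsTree ∧ leaves T = attachments H B ∧ T.edgeSet.ncard = n}

/-- In a finite graph these numbers are bounded, so that `bridgeLength` is a genuine maximum
whenever there is such a tree. -/
theorem bddAbove_attachmentTreeSizes [Finite V] (H B : G.Subgraph) :
    BddAbove (attachmentTreeSizes H B) := by
  refine ⟨G.edgeSet.ncard, ?_⟩
  rintro n ⟨T, -, -, -, rfl⟩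
  exact Set.ncard_le_ncard T.edgeSet_subset (Set.toFinite _)

/-- The length `λ(B)` of an `H`-bridge `B`: the maximum number of edges of a tree in `B` whose
leaves are exactly the attachments of `B`. -/
noncomputable def bridgeLength (H B : G.Subgraph) : ℕ := sSup (attachmentTreeSizes H B)

/-- The cycle `L` can be partitioned into two subpaths `p` and `q` (edge-disjoint, with union `L`,
hence meeting exactly in their two common ends) such that the attachments of `B₁` all lie on `p`
and the attachments of `B₂` all lie on `q`. -/
def Avoid (L B₁ B₂ : G.Subgraph) : Prop :=
  ∃ (x y : V) (p : G.Walk x y) (q : G.Walk y x),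
    p.IsPath ∧ q.IsPath ∧
    Disjoint p.toSubgraph.edgeSet q.toSubgraph.edgeSet ∧
    p.toSubgraph ⊔ q.toSubgraph = L ∧
    attachments L B₁ ⊆ p.toSubgraph.verts ∧
    attachments L B₂ ⊆ q.toSubgraph.verts

theorem Avoid.symm {L B₁ B₂ : G.Subgraph} (h : Avoid L B₁ B₂) : Avoid L B₂ B₁ := by
  obtain ⟨x, y, p, q, hp, hq, hd, hu, h₁, h₂⟩ := h
  exact ⟨y, x, q, p, hq, hp, hd.symm, by rw [sup_comm, hu], h₂, h₁⟩

/-- The overlap graph `O_G(L)`: its vertices are the `L`-bridges, and two distinct bridges are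
adjacent if and only if they overlap, that is, do not avoid each other. -/
def overlapGraph (L : G.Subgraph) : SimpleGraph (BridgeOf L) where
  Adj B₁ B₂ := B₁ ≠ B₂ ∧ ¬ Avoid L B₁.1 B₂.1
  symm := ⟨fun _ _ h => ⟨h.1.symm, fun h' => h.2 h'.symm⟩⟩
  loopless := ⟨fun _ h => h.1 rfl⟩

end BridgesOfCycles

/-!
Let `n` be the length of the longest cycle `L`. An exchange leaves out some pieces of `L` and
closes up the remaining pieces to a new cycle by paths through bridges; as the new cycle is not
longer than `L`, the inserted paths are at most as long as the omitted pieces. The bound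
`2 * ∑ λ(B) ≤ n` is the sum of a suitable family of exchanges.

If `λ(B)` is the number of edges of a tree `T` in `B`, each edge of `T` cuts the attachments of `B`
into two nonempty classes, and two attachments are joined through `B` by a path that is at least as
long as the number of cuts separating them (`exists_cuts`). So it suffices to find exchanges such
that every piece of `L` is left out twice altogether, and such that for each bridge `B` the
pairs of attachments that are joined through `B` form a `4`-edge-connected multigraph: then every
cut separates at least four of these pairs, and the sum of the exchanges is `4 * ∑ λ(B) ≤ 2 * n`.

The exchanges are built by recursion along intervals of `L`. Fix a bridge `p` and an interval such
that every other bridge is attached either only inside or only outside it. A tracing of the interval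
(`IsTraced`) consists of some exchanges that close up within it and four more paths that enter it,
two at either end, and run to attachments of `p`, so that the multigraph on the attachments
of `p` in the interval has four dangling edges (`IsFourCut`). Two consecutive traced intervals are
concatenated by closing two of the paths of each with one another through `p`
(`IsTraced.exists_append`). If the interval begins and ends with attachments of one component `D` of
the overlap tree minus `p`, let `c` be the neighbour of `p` in `D`. The interval then falls into
subintervals with attachments from `D` and subintervals with attachments from outside `D`, in
turn (`exists_isAlternating`); the former are traced with `c` in place of `p`, the latter with `p`.
As the overlap graph is a tree, `c` is the only bridge of `D` that crosses `p`, so these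
subintervals again separate the remaining bridges. Joining consecutive subintervals of the first
kind through `c`, and consecutive ones of the second kind through `p`, gives exchanges that leave out
neither kind too often (`IsAlternating.exists_isTraced`). Hence every such interval can be traced if
it begins with an attachment and `p` is also attached outside it (`exists_isTraced`). For the
whole cycle, cut open at an attachment of some `p`, the four paths are closed through that
attachment (`two_mul_sum_card_le`).

Disjoint bridges overlap if and only if their attachments alternate around `L`
(`avoid_of_not_cross`, `not_cross_of_avoid`), so the argument applies to the overlap graph.
-/

namespace BridgesOfCycles

/-! ### Paths of prescribed minimal size inside a vertex set -/

/-- Inside the vertex set `W` there is a path from `x` to `y` with at least `l` vertices.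
Vertices rather than edges are counted, so that sizes add up under concatenation; `l` is an
integer so that it may be a sum of terms of either sign. -/
def HasPath {V : Type*} (G : SimpleGraph V) (W : Set V) (x y : V) (l : ℤ) : Prop :=
  ∃ w : G.Walk x y, w.IsPath ∧ (∀ z ∈ w.support, z ∈ W) ∧ l ≤ w.length + 1

namespace HasPath

variable {V : Type*} {G : SimpleGraph V} {W W' : Set V} {x y z y' : V} {l l' : ℤ}

lemma refl (h : x ∈ W) : HasPath G W x x 1 :=
  ⟨.nil, .nil, by simpa using h, by simp⟩

lemma mono (h : HasPath G W x y l) (hW : W ⊆ W') (hl : l' ≤ l) : HasPath G W' x y l' := by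
  obtain ⟨w, h1, h2, h3⟩ := h
  exact ⟨w, h1, fun z hz => hW (h2 z hz), hl.trans h3⟩

lemma symm (h : HasPath G W x y l) : HasPath G W y x l := by
  obtain ⟨w, h1, h2, h3⟩ := h
  exact ⟨w.reverse, h1.reverse, fun z hz => h2 z (by simpa using hz), by simpa using h3⟩

lemma append (h : HasPath G W x y l) (hadj : G.Adj y y') (h' : HasPath G W' y' z l')
    (hd : Disjoint W W') : HasPath G (W ∪ W') x z (l + l') := by
  obtain ⟨w, h1, h2, h3⟩ := h
  obtain ⟨w', h1', h2', h3'⟩ := h'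
  refine ⟨w.append (.cons hadj w'), ?_, ?_, ?_⟩
  · rw [SimpleGraph.Walk.isPath_def, SimpleGraph.Walk.support_append]
    simp only [SimpleGraph.Walk.support_cons, List.tail_cons]
    refine List.Nodup.append h1.support_nodup h1'.support_nodup ?_
    intro a ha hb
    exact Set.disjoint_left.mp hd (h2 a ha) (h2' a hb)
  · intro a ha
    rw [SimpleGraph.Walk.mem_support_append_iff] at ha
    rcases ha with ha | ha
    · exact Or.inl (h2 a ha)
    · rw [SimpleGraph.Walk.support_cons, List.mem_cons] at ha
      rcases ha with rfl | ha
      · exact Or.inl (h2 _ w.end_mem_support)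
      · exact Or.inr (h2' a ha)
  · simp only [SimpleGraph.Walk.length_append, SimpleGraph.Walk.length_cons]
    push_cast
    linarith

end HasPath

/-! ### Cyclic sequences of vertices -/

/-- The bi-infinite, `n`-periodic sequence `v` runs around a cycle of length `n` of `G`, and no
cycle of `G` is longer. Indexing by all integers makes every rotation of the cycle a shift. -/
structure IsLongestCyclicSeq {V : Type*} (G : SimpleGraph V) (v : ℤ → V) (n : ℤ) : Prop where
  three_le : 3 ≤ n
  periodic : ∀ i, v (i + n) = v i
  inj : ∀ i j, v i = v j → i < j + n → j < i + n → i = j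
  adj : ∀ i, G.Adj (v i) (v (i + 1))
  longest : ∀ (x : V) (C : G.Walk x x), C.IsCycle → (C.length : ℤ) ≤ n

/-- The vertices at the positions `s, …, t - 1`. -/
def arc {V : Type*} (v : ℤ → V) (s t : ℤ) : Set V := v '' Set.Ico s t

section arc

variable {V : Type*} {v : ℤ → V} {s t r : ℤ}

lemma mem_arc {i : ℤ} (h1 : s ≤ i) (h2 : i < t) : v i ∈ arc v s t := ⟨i, ⟨h1, h2⟩, rfl⟩

lemma arc_union (h1 : s ≤ r) (h2 : r ≤ t) : arc v s r ∪ arc v r t = arc v s t := by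
  rw [arc, arc, ← Set.image_union, Set.Ico_union_Ico_eq_Ico h1 h2, arc]

lemma arc_mono {s' t' : ℤ} (h1 : s' ≤ s) (h2 : t ≤ t') : arc v s t ⊆ arc v s' t' :=
  Set.image_mono (Set.Ico_subset_Ico h1 h2)

@[simp] lemma arc_self : arc v s s = ∅ := by simp [arc]

end arc

namespace IsLongestCyclicSeq

variable {V : Type*} {G : SimpleGraph V} {v : ℤ → V} {n : ℤ} (hv : IsLongestCyclicSeq G v n)
include hv

lemma adj' {i j : ℤ} (h : j = i + 1) : G.Adj (v i) (v j) := h ▸ hv.adj i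

lemma arc_disjoint {s t s' t' : ℤ} (h1 : t ≤ s') (h2 : t' ≤ s + n) :
    Disjoint (arc v s t) (arc v s' t') := by
  rw [Set.disjoint_left]
  rintro _ ⟨i, ⟨hi1, hi2⟩, rfl⟩ ⟨j, ⟨hj1, hj2⟩, hij⟩
  have := hv.inj i j hij.symm (by omega) (by omega)
  omega

/-- A path whose ends are adjacent closes up to a cycle, so it is not longer than `n`. -/
lemma le_of_adj {W : Set V} {x y : V} {l : ℤ} (h : HasPath G W x y l) (hadj : G.Adj y x) :
    l ≤ n := by
  obtain ⟨w, h1, -, h3⟩ := h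
  have h3n := hv.three_le
  by_cases hl : w.length < 2
  · omega
  · have hc : (SimpleGraph.Walk.cons hadj w).IsCycle := by
      rw [SimpleGraph.Walk.cons_isCycle_iff]
      refine ⟨h1, fun hmem => ?_⟩
      cases w with
      | nil => simp at hl
      | cons h' w' =>
        rw [SimpleGraph.Walk.cons_isPath_iff] at h1
        rw [SimpleGraph.Walk.edges_cons, List.mem_cons] at hmem
        rcases hmem with hmem | hmem
        · -- the first edge leads to the end vertex, so the remaining path is trivial
          rw [Sym2.eq_swap, Sym2.congr_right] at hmem
          subst hmem
          rw [SimpleGraph.Walk.length_cons, SimpleGraph.Walk.length_eq_zero_iff.mpr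
            (SimpleGraph.Walk.isPath_iff_nil.mp h1.1)] at hl
          simp at hl
        · exact h1.2 (SimpleGraph.Walk.snd_mem_support_of_mem_edges _ hmem)
    have := hv.longest _ _ hc
    simp only [SimpleGraph.Walk.length_cons] at this
    push_cast at this
    omega

lemma hasPath_arc_append {W : Set V} {y : V} {l s t : ℤ} (h : HasPath G W (v t) y l)
    (hst : s ≤ t) (htn : t ≤ s + n) (hd : Disjoint (arc v s t) W) :
    HasPath G (arc v s t ∪ W) (v s) y (l + (t - s)) := by
  obtain ⟨k, rfl⟩ : ∃ k : ℕ, t = s + k := ⟨(t - s).toNat, by omega⟩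
  induction k generalizing s with
  | zero => simpa using h
  | succ k ih =>
    have hu := arc_union (v := v) (s := s) (r := s + 1) (t := s + (k + 1 : ℕ)) (by omega) (by omega)
    have h1 := @ih (s + 1) (by convert h using 2; push_cast; ring) (by omega)
      (by push_cast at htn; omega)
      (hd.mono_left (arc_mono (by omega) (by push_cast; omega)))
    have h2 : HasPath G (arc v s (s + 1)) (v s) (v s) 1 := .refl (mem_arc le_rfl (by omega))
    have h3 := h2.append (hv.adj s) h1 (by
      rw [Set.disjoint_union_right]
      refine ⟨hv.arc_disjoint le_rfl (by push_cast at htn; omega), ?_⟩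
      exact hd.mono_left (arc_mono (by omega) (by push_cast; omega)))
    refine h3.mono ?_ (by push_cast; omega)
    rw [← Set.union_assoc, ← hu]
    refine Set.union_subset_union_left _ (Set.union_subset_union_right _ ?_)
    exact arc_mono le_rfl (by push_cast; omega)

lemma hasPath_arc_append_rev {W : Set V} {y : V} {l s t : ℤ} (h : HasPath G W (v (s - 1)) y l)
    (hst : s ≤ t) (htn : t ≤ s + n) (hd : Disjoint (arc v s t) W) :
    HasPath G (arc v s t ∪ W) (v (t - 1)) y (l + (t - s)) := by
  obtain ⟨k, rfl⟩ : ∃ k : ℕ, t = s + k := ⟨(t - s).toNat, by omega⟩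
  clear hst
  induction k with
  | zero => simpa using h
  | succ k ih =>
    push_cast at htn hd ⊢
    have hu := arc_union (v := v) (s := s) (r := s + k) (t := s + (k + 1)) (by omega) (by omega)
    have h1 := ih (by omega) (hd.mono_left (arc_mono le_rfl (by omega)))
    have h2 : HasPath G (arc v (s + k) (s + (k + 1))) (v (s + (k + 1) - 1)) (v (s + k)) 1 := by
      rw [show s + ((k : ℤ) + 1) - 1 = s + k by ring]
      exact .refl (mem_arc le_rfl (by omega))
    have h3 := h2.append (hv.adj' (i := s + k - 1) (by omega)).symm h1 (by
      rw [Set.disjoint_union_right]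
      refine ⟨(hv.arc_disjoint le_rfl (by omega)).symm, ?_⟩
      exact hd.mono_left (arc_mono (by omega) (by omega)))
    refine h3.mono ?_ (by omega)
    rw [← Set.union_assoc, ← hu, Set.union_comm (arc v s (s + k))]

lemma hasPath_arc {s t : ℤ} (hst : s < t) (htn : t ≤ s + n) :
    HasPath G (arc v s t) (v s) (v (t - 1)) (t - s) := by
  have h2 : HasPath G (arc v (t - 1) t) (v (t - 1)) (v (t - 1)) 1 :=
    .refl (mem_arc le_rfl (by omega))
  have h := hv.hasPath_arc_append (s := s) h2 (by omega) (by omega)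
    (hv.arc_disjoint le_rfl (by omega))
  rw [arc_union (by omega) (by omega)] at h
  exact h.mono subset_rfl (by omega)

/-- Replacing the part of the longest cycle at the positions `s, …, t - 1` by another path between
the same ends cannot produce a longer cycle. -/
lemma le_of_hasPath {W : Set V} {l s t : ℤ} (h : HasPath G W (v s) (v (t - 1)) l) (hst : s < t)
    (htn : t ≤ s + n) (hd : Disjoint W (arc v t (s + n))) : l ≤ t - s := by
  rcases htn.eq_or_lt with rfl | hlt
  · have := hv.le_of_adj h (by
      rw [← hv.periodic s]; exact hv.adj' (by omega))
    omega
  · have h1 := hv.hasPath_arc (s := t) (t := s + n) hlt (by omega)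
    have h2 := h.append (hv.adj' (by omega)) h1 hd
    have := hv.le_of_adj h2 (by
      rw [← hv.periodic s]; exact hv.adj' (by omega))
    omega

/-- The exchange behind crossing jumps: of four consecutive arcs `P = [a, b)`, `Q = [b, c)`,
`P' = [c, d)`, `Q' = [d, e)`, let one path join the first vertices of `P` and `P'`, and another,
disjoint one the last vertices of `Q` and `Q'`. Together they reconnect the cycle. -/
lemma add_le_of_hasPath_of_hasPath {W W' : Set V} {l l' a b c d e : ℤ} (hab : a < b)
    (hbc : b < c) (hcd : c < d) (hde : d < e) (hen : e ≤ a + n)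
    (h : HasPath G W (v a) (v c) l) (h' : HasPath G W' (v (c - 1)) (v (e - 1)) l')
    (hd : Disjoint W W') (hW : Disjoint W (arc v e (a + n)))
    (hW' : Disjoint W' (arc v e (a + n))) : l + l' ≤ e - a :=
  hv.le_of_hasPath (h.append (hv.adj' (by omega)).symm h' hd) (by omega) hen
    (Set.disjoint_union_left.mpr ⟨hW, hW'⟩)

end IsLongestCyclicSeq

/-! ### Cuts of a set with four dangling ends -/

/-- `1` if the cut `φ` separates `a` from `b`, and `0` otherwise. -/
def sep {V : Type*} (φ : V → Bool) (a b : V) : ℕ := if φ a = φ b then 0 else 1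

/-- `1` if `a` does not lie on the side `τ` of the cut `φ`, and `0` otherwise. -/
def off {V : Type*} (φ : V → Bool) (τ : Bool) (a : V) : ℕ := if φ a = τ then 0 else 1

/-- Think of a multigraph on the vertex set `S` that has, besides its ordinary edges, four dangling
edges with ends `x₁ x₂ y₁ y₂`; the cut `φ` separates the ends of `c` of its ordinary edges. The
predicate says that once the dangling edges are joined to a further vertex on an arbitrary side of
`φ`, the cut is either trivial or separates the ends of at least four edges. For all `φ` together
this is `4`-edge-connectivity. -/
structure IsFourCut {V : Type*} (φ : V → Bool) (S : Set V) (c : ℕ) (x₁ x₂ y₁ y₂ : V) : Prop where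
  mem₁ : x₁ ∈ S
  mem₂ : x₂ ∈ S
  mem₃ : y₁ ∈ S
  mem₄ : y₂ ∈ S
  four_le : ∀ τ, (∀ a ∈ S, φ a = τ) ∨ 4 ≤ c + off φ τ x₁ + off φ τ x₂ + off φ τ y₁ + off φ τ y₂

namespace IsFourCut

variable {V : Type*} {φ : V → Bool} {S S' : Set V} {c c' : ℕ} {x₁ x₂ y₁ y₂ x₁' x₂' y₁' y₂' : V}

lemma singleton (a : V) : IsFourCut φ {a} 0 a a a a := by
  refine ⟨rfl, rfl, rfl, rfl, fun τ => ?_⟩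
  by_cases h : φ a = τ <;> simp [off, h]

lemma off_le (φ : V → Bool) (τ : Bool) (a b : V) : off φ τ a ≤ sep φ a b + off φ τ b := by
  unfold off sep
  split_ifs <;> simp_all

lemma off_le' (φ : V → Bool) (τ : Bool) (a b : V) : off φ τ b ≤ sep φ a b + off φ τ a := by
  unfold off sep
  split_ifs <;> simp_all

lemma off_eq_zero {τ : Bool} {a : V} (h : φ a = τ) : off φ τ a = 0 := by simp [off, h]

lemma off_eq_one {σ τ : Bool} {a : V} (h : φ a = σ) (hs : σ ≠ τ) : off φ τ a = 1 := by
  simp [off, h, hs]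

/-- Either the cut is trivial, or it separates at least two ordinary edges whatever happens to the
dangling ones: average the two sides of the further vertex. -/
lemma const_or_two_le (h : IsFourCut φ S c x₁ x₂ y₁ y₂) :
    (∃ τ, ∀ a ∈ S, φ a = τ) ∨ (2 ≤ c ∧
      ∀ τ, 4 ≤ c + off φ τ x₁ + off φ τ x₂ + off φ τ y₁ + off φ τ y₂) := by
  by_cases hc : ∃ τ, ∀ a ∈ S, φ a = τ
  · exact Or.inl hc
  · have h4 : ∀ τ, 4 ≤ c + off φ τ x₁ + off φ τ x₂ + off φ τ y₁ + off φ τ y₂ := fun τ =>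
      (h.four_le τ).resolve_left fun h' => hc ⟨τ, h'⟩
    have hs : ∀ a, off φ true a + off φ false a = 1 := fun a => by
      unfold off
      cases φ a <;> rfl
    have := h4 true
    have := h4 false
    have := hs x₁
    have := hs x₂
    have := hs y₁
    have := hs y₂
    exact Or.inr ⟨by omega, h4⟩

/-- Joining two dangling edges of one such multigraph to two dangling edges of another. -/
lemma merge (h : IsFourCut φ S c x₁ x₂ y₁ y₂) (h' : IsFourCut φ S' c' x₁' x₂' y₁' y₂') :
    IsFourCut φ (S ∪ S') (c + c' + sep φ y₁ x₁' + sep φ y₂ x₂') x₁ x₂ y₁' y₂' := by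
  refine ⟨.inl h.mem₁, .inl h.mem₂, .inr h'.mem₃, .inr h'.mem₄, fun τ => ?_⟩
  have t1 := off_le φ τ y₁ x₁'
  have t2 := off_le φ τ y₂ x₂'
  have t3 := off_le' φ τ y₁ x₁'
  have t4 := off_le' φ τ y₂ x₂'
  rcases h.const_or_two_le with ⟨σ, hc⟩ | ⟨hc, h4⟩ <;>
    rcases h'.const_or_two_le with ⟨σ', hc'⟩ | ⟨hc', h4'⟩
  · by_cases hs : σ = τ <;> by_cases hs' : σ' = τ
    · left
      rintro a (ha | ha)
      · rw [hc a ha, hs]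
      · rw [hc' a ha, hs']
    all_goals right
    · rw [off_eq_zero ((hc _ h.mem₃).trans hs)] at t3
      rw [off_eq_zero ((hc _ h.mem₄).trans hs)] at t4
      rw [off_eq_one (hc' _ h'.mem₁) hs'] at t3
      rw [off_eq_one (hc' _ h'.mem₂) hs'] at t4
      rw [off_eq_one (hc' _ h'.mem₃) hs', off_eq_one (hc' _ h'.mem₄) hs']
      omega
    · rw [off_eq_one (hc _ h.mem₃) hs] at t1
      rw [off_eq_one (hc _ h.mem₄) hs] at t2
      rw [off_eq_zero ((hc' _ h'.mem₁).trans hs')] at t1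
      rw [off_eq_zero ((hc' _ h'.mem₂).trans hs')] at t2
      rw [off_eq_one (hc _ h.mem₁) hs, off_eq_one (hc _ h.mem₂) hs]
      omega
    · rw [off_eq_one (hc _ h.mem₁) hs, off_eq_one (hc _ h.mem₂) hs,
        off_eq_one (hc' _ h'.mem₃) hs', off_eq_one (hc' _ h'.mem₄) hs']
      omega
  · right
    have := h4' τ
    by_cases hs : σ = τ
    · rw [off_eq_zero ((hc _ h.mem₃).trans hs)] at t3
      rw [off_eq_zero ((hc _ h.mem₄).trans hs)] at t4
      omega
    · rw [off_eq_one (hc _ h.mem₁) hs, off_eq_one (hc _ h.mem₂) hs]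
      omega
  · right
    have := h4 τ
    by_cases hs : σ' = τ
    · rw [off_eq_zero ((hc' _ h'.mem₁).trans hs)] at t1
      rw [off_eq_zero ((hc' _ h'.mem₂).trans hs)] at t2
      omega
    · rw [off_eq_one (hc' _ h'.mem₃) hs, off_eq_one (hc' _ h'.mem₄) hs]
      omega
  · right
    omega

/-- Joining all four dangling edges of one such multigraph to those of another. -/
lemma close (h : IsFourCut φ S c x₁ x₂ y₁ y₂) (h' : IsFourCut φ S' c' x₁' x₂' y₁' y₂')
    (hne : ∃ a ∈ S ∪ S', ∃ b ∈ S ∪ S', φ a ≠ φ b) :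
    4 ≤ c + c' + sep φ y₁ x₁' + sep φ y₂ x₂' + sep φ y₁' x₁ + sep φ y₂' x₂ := by
  rcases h.const_or_two_le with ⟨σ, hc⟩ | ⟨hc, h4⟩
  · rcases (h.merge h').four_le σ with h5 | h5
    · obtain ⟨a, ha, b, hb, hab⟩ := hne
      exact absurd ((h5 a ha).trans (h5 b hb).symm) hab
    · have t1 := off_le φ σ y₁' x₁
      have t2 := off_le φ σ y₂' x₂
      rw [off_eq_zero (hc _ h.mem₁)] at t1 h5
      rw [off_eq_zero (hc _ h.mem₂)] at t2 h5
      omega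
  · rcases h'.const_or_two_le with ⟨σ, hc'⟩ | ⟨hc', h4'⟩
    · have := h4 σ
      have t1 := off_le' φ σ y₁' x₁
      have t2 := off_le' φ σ y₂' x₂
      have t3 := off_le φ σ y₁ x₁'
      have t4 := off_le φ σ y₂ x₂'
      rw [off_eq_zero (hc' _ h'.mem₃)] at t1
      rw [off_eq_zero (hc' _ h'.mem₄)] at t2
      rw [off_eq_zero (hc' _ h'.mem₁)] at t3
      rw [off_eq_zero (hc' _ h'.mem₂)] at t4
      omega
    · omega

/-- A chain of such multigraphs, each joined to the next by two edges. -/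
lemma chain {S : ℕ → Set V} {c : ℕ → ℕ} {x₁ x₂ y₁ y₂ : ℕ → V} {m : ℕ}
    (h : ∀ i ≤ m, IsFourCut φ (S i) (c i) (x₁ i) (x₂ i) (y₁ i) (y₂ i)) :
    IsFourCut φ (⋃ i ≤ m, S i)
      (∑ i ∈ Finset.range (m + 1), c i + ∑ i ∈ Finset.range m, sep φ (y₁ i) (x₁ (i + 1)) +
        ∑ i ∈ Finset.range m, sep φ (y₂ i) (x₂ (i + 1))) (x₁ 0) (x₂ 0) (y₁ m) (y₂ m) := by
  induction m with
  | zero => simpa using h 0 le_rfl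
  | succ m ih =>
    have h1 := (ih fun i hi => h i (by omega)).merge (h (m + 1) le_rfl)
    have hS : (⋃ i ≤ m + 1, S i) = (⋃ i ≤ m, S i) ∪ S (m + 1) := by
      ext a
      simp only [Set.mem_iUnion, Set.mem_union, exists_prop, Nat.le_succ_iff, or_and_right,
        exists_or, exists_eq_left]
    rw [hS, Finset.sum_range_succ c (m + 1),
      Finset.sum_range_succ (fun i => sep φ (y₁ i) (x₁ (i + 1))) m,
      Finset.sum_range_succ (fun i => sep φ (y₂ i) (x₂ (i + 1))) m]
    convert h1 using 1
    ring

/-- A closed chain of at least two such multigraphs, each joined to the next by two edges. -/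
lemma cycle {S : ℕ → Set V} {c : ℕ → ℕ} {x₁ x₂ y₁ y₂ : ℕ → V} {m : ℕ} (hm : 1 ≤ m)
    (h : ∀ i ≤ m, IsFourCut φ (S i) (c i) (x₁ i) (x₂ i) (y₁ i) (y₂ i))
    (hne : ∃ a ∈ ⋃ i ≤ m, S i, ∃ b ∈ ⋃ i ≤ m, S i, φ a ≠ φ b) :
    4 ≤ ∑ i ∈ Finset.range (m + 1), c i +
      (∑ i ∈ Finset.range m, sep φ (y₁ i) (x₁ (i + 1)) + sep φ (y₁ m) (x₁ 0)) +
      (∑ i ∈ Finset.range m, sep φ (y₂ i) (x₂ (i + 1)) + sep φ (y₂ m) (x₂ 0)) := by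
  obtain ⟨m, rfl⟩ : ∃ k, m = k + 1 := ⟨m - 1, by omega⟩
  have hS : (⋃ i ≤ m + 1, S i) = (⋃ i ≤ m, S i) ∪ S (m + 1) := by
    ext a
    simp only [Set.mem_iUnion, Set.mem_union, exists_prop, Nat.le_succ_iff, or_and_right,
      exists_or, exists_eq_left]
  rw [hS] at hne
  have h1 := (chain (m := m) fun i hi => h i (by omega)).close (h (m + 1) le_rfl) hne
  rw [Finset.sum_range_succ c (m + 1),
    Finset.sum_range_succ (fun i => sep φ (y₁ i) (x₁ (i + 1))) m,
    Finset.sum_range_succ (fun i => sep φ (y₂ i) (x₂ (i + 1))) m]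
  omega

end IsFourCut

/-! ### Crossing sets of positions on a cycle -/

/-- Two vertex sets cross on the `n`-periodic sequence `v` if members of the first and of the second
alternate around the cycle. -/
def Cross {V : Type*} (v : ℤ → V) (n : ℤ) (A B : Set V) : Prop :=
  ∃ i j k l, i < j ∧ j < k ∧ k < l ∧ l < i + n ∧ v i ∈ A ∧ v j ∈ B ∧ v k ∈ A ∧ v l ∈ B

lemma exists_shift {V : Type*} {v : ℤ → V} {n : ℤ} (hn : 0 < n) (hper : ∀ i, v (i + n) = v i)
    (i s : ℤ) : ∃ d, (∀ x, v (x + d) = v x) ∧ s ≤ i + d ∧ i + d < s + n := by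
  have hp : Function.Periodic v n := hper
  refine ⟨(-((i - s) / n) : ℤ) * n, fun x => hp.int_mul _ x, ?_, ?_⟩
  · have := Int.emod_nonneg (i - s) hn.ne'
    rw [Int.emod_def] at this
    linarith
  · have := Int.emod_lt_of_pos (i - s) hn
    rw [Int.emod_def] at this
    linarith

namespace IsLongestCyclicSeq

variable {V : Type*} {G : SimpleGraph V} {v : ℤ → V} {n : ℤ} (hv : IsLongestCyclicSeq G v n)
include hv

lemma exists_pos {x : V} (hx : x ∈ Set.range v) (s : ℤ) : ∃ i, v i = x ∧ s ≤ i ∧ i < s + n := by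
  obtain ⟨j, rfl⟩ := hx
  obtain ⟨d, h1, h2, h3⟩ := exists_shift (by have := hv.three_le; omega) hv.periodic j s
  exact ⟨j + d, h1 j, h2, h3⟩

lemma mem_arc_iff {i s t : ℤ} (h1 : s ≤ i) (h2 : i < s + n) (ht : t ≤ s + n) :
    v i ∈ arc v s t ↔ i < t := by
  constructor
  · rintro ⟨j, ⟨hj1, hj2⟩, hj⟩
    have := hv.inj i j hj.symm (by omega) (by omega)
    omega
  · intro h
    exact mem_arc h1 h

lemma cross_symm {A B : Set V} (h : Cross v n A B) : Cross v n B A := by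
  obtain ⟨i, j, k, l, h1, h2, h3, h4, hi, hj, hk, hl⟩ := h
  exact ⟨j, k, l, i + n, h2, h3, h4, by omega, hj, hk, hl, by rwa [hv.periodic]⟩

lemma exists_between_of_cross {A B : Set V} (h : Cross v n A B) {s t : ℤ} (hA : A ⊆ arc v s t)
    (ht : t ≤ s + n) :
    ∃ a b a', s ≤ a ∧ a < b ∧ b < a' ∧ a' < t ∧ v a ∈ A ∧ v b ∈ B ∧ v a' ∈ A := by
  obtain ⟨i, j, k, l, h1, h2, h3, h4, hi, hj, hk, hl⟩ := h
  obtain ⟨d, hd, hd1, hd2⟩ := exists_shift (by have := hv.three_le; omega) hv.periodic i s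
  have hi' := (hv.mem_arc_iff hd1 hd2 ht).mp (hA (by rwa [hd]))
  by_cases hk' : k + d < s + n
  · have := (hv.mem_arc_iff (i := k + d) (by omega) hk' ht).mp (hA (by rwa [hd]))
    exact ⟨i + d, j + d, k + d, hd1, by omega, by omega, this, by rwa [hd], by rwa [hd],
      by rwa [hd]⟩
  · have hp : ∀ x, v (x - n) = v x := fun x => by rw [← hv.periodic (x - n), sub_add_cancel]
    exact ⟨k + d - n, l + d - n, i + d, by omega, by omega, by omega, hi', by rwa [hp, hd],
      by rwa [hp, hd], by rwa [hd]⟩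

end IsLongestCyclicSeq

/-! ### Separating a tree at an edge -/

/-- The vertex set `X` is connected in `T`. -/
def ConnectedIn {ι : Type*} (T : SimpleGraph ι) (X : Set ι) : Prop :=
  ∀ x ∈ X, ∀ y ∈ X, Relation.ReflTransGen (fun a b => T.Adj a b ∧ b ∈ X) x y

/-- `D` is the connected side containing `c` of a cut of `T` with `c p` as its only edge. -/
structure IsBranch {ι : Type*} (T : SimpleGraph ι) (D : Set ι) (c p : ι) : Prop where
  mem : c ∈ D
  notMem : p ∉ D
  adj : T.Adj c p
  eq_of_adj : ∀ y ∈ D, ∀ z, z ∉ D → T.Adj y z → y = c ∧ z = p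
  connected : ConnectedIn T D

namespace IsBranch

variable {ι : Type*} {T : SimpleGraph ι} {D D' : Set ι} {c c' p : ι}

lemma exists_of_isTree (hT : T.IsTree) {x : ι} (hx : x ≠ p) :
    ∃ D c, IsBranch T D c p ∧ x ∈ D := by
  obtain ⟨w, hw⟩ := hT.connected.exists_isPath p x
  cases w with
  | nil => exact absurd rfl hx
  | @cons _ c _ h q =>
    rw [SimpleGraph.Walk.cons_isPath_iff] at hw
    have hb := SimpleGraph.isAcyclic_iff_forall_adj_isBridge.mp hT.isAcyclic h.symm
    rw [SimpleGraph.isBridge_iff] at hb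
    refine ⟨{z | (T.deleteEdges {s(c, p)}).Reachable c z}, c,
      ⟨.refl _, hb, h.symm, ?_, ?_⟩, ?_⟩
    · intro y hy z hz hyz
      by_cases he : s(y, z) = s(c, p)
      · rw [Sym2.eq_iff] at he
        rcases he with he | ⟨rfl, rfl⟩
        · exact he
        · exact absurd hy hb
      · exact absurd (hy.trans (SimpleGraph.Adj.reachable
          (SimpleGraph.deleteEdges_adj.mpr ⟨hyz, by simpa using he⟩))) hz
    · intro y hy z hz
      obtain ⟨r⟩ := hy.symm.trans hz
      clear hz
      induction r with
      | nil => exact .refl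
      | cons hadj r ih =>
        have h2 := hy.trans hadj.reachable
        exact .head ⟨(SimpleGraph.deleteEdges_adj.mp hadj).1, h2⟩ (ih h2)
    · refine ⟨q.toDeleteEdges {s(c, p)} ?_⟩
      rintro e he rfl
      exact hw.2 (SimpleGraph.Walk.snd_mem_support_of_mem_edges _ he)

lemma disjoint (h : IsBranch T D c p) (h' : IsBranch T D' c' p) {y : ι} (hy : y ∈ D')
    (hyD : y ∉ D) : Disjoint D D' := by
  rw [Set.disjoint_left]
  intro z hz hz'
  have hr := h'.connected z hz' y hy
  refine hyD ?_
  clear hyD hy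
  induction hr with
  | refl => exact hz
  | tail _ hab ih =>
    by_contra hb
    exact h'.notMem ((h.eq_of_adj _ ih _ hb hab.1).2 ▸ hab.2)

lemma not_adj (h : IsBranch T D c p) (h' : IsBranch T D' c' p) (hd : Disjoint D D') {y z : ι}
    (hy : y ∈ D) (hz : z ∈ D') : ¬ T.Adj y z := fun hyz =>
  h'.notMem ((h.eq_of_adj y hy z (fun hz' => Set.disjoint_left.mp hd hz' hz) hyz).2 ▸ hz)

end IsBranch

/-! ### Systems of disjoint bridges -/

/-- What the proof uses of a longest cycle and disjoint bridges `x : ι` whose overlap graph is a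
tree `T`. The length of the bridge `x` is the number of elements of `cuts x`, and each of these
elements (the edges of a tree in the bridge) cuts the attachments `att x` in two sides, as told
by `side x`. The path through a bridge given by `jump` is at least as long as the number of cuts
separating its ends. -/
structure BridgeSystem {V : Type*} (G : SimpleGraph V) (ι : Type*) where
  /-- the vertices of the longest cycle, in cyclic order -/
  v : ℤ → V
  /-- the length of the longest cycle -/
  n : ℤ
  cyc : IsLongestCyclicSeq G v n
  /-- the attachments of a bridge -/
  att : ι → Set V
  /-- the vertices of a bridge off the cycle -/
  inner : ι → Set V
  /-- the edges of a tree in the bridge -/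
  cuts : ι → Finset (Sym2 V)
  /-- the two sides of the tree in which an edge of it leaves the vertices -/
  side : ι → Sym2 V → V → Bool
  /-- the overlap graph -/
  T : SimpleGraph ι
  att_subset : ∀ x, att x ⊆ Set.range v
  att_disjoint : ∀ x y, x ≠ y → Disjoint (att x) (att y)
  inner_disjoint : ∀ x y, x ≠ y → Disjoint (inner x) (inner y)
  inner_off : ∀ x, Disjoint (inner x) (Set.range v)
  jump : ∀ x, ∀ a ∈ att x, ∀ b ∈ att x, a ≠ b → ∃ w : G.Walk a b, w.IsPath ∧
    (∀ z ∈ w.support, z = a ∨ z = b ∨ z ∈ inner x) ∧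
    ∑ e ∈ cuts x, sep (side x e) a b ≤ w.length
  side_ne : ∀ x, ∀ e ∈ cuts x, ∃ a ∈ att x, ∃ b ∈ att x, side x e a ≠ side x e b
  tree : T.IsTree
  adj_iff : ∀ x y, x ≠ y → (T.Adj x y ↔ Cross v n (att x) (att y))

namespace BridgeSystem

variable {V ι : Type*} {G : SimpleGraph V} (S : BridgeSystem G ι)

/-- All attachments of the bridges in `X`. -/
def letters (X : Set ι) : Set V := ⋃ x ∈ X, S.att x

variable {S}

lemma mem_letters {X : Set ι} {z : V} : z ∈ S.letters X ↔ ∃ x ∈ X, z ∈ S.att x := by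
  simp [letters]

lemma mem_letters_of_mem {X : Set ι} {x : ι} (hx : x ∈ X) {z : V} (hz : z ∈ S.att x) :
    z ∈ S.letters X := mem_letters.mpr ⟨x, hx, hz⟩

lemma eq_of_mem_att {x y : ι} {z : V} (hx : z ∈ S.att x) (hy : z ∈ S.att y) : x = y := by
  by_contra h
  exact Set.disjoint_left.mp (S.att_disjoint x y h) hx hy

lemma mem_of_mem_letters {X : Set ι} {x : ι} {z : V} (h : z ∈ S.letters X) (hz : z ∈ S.att x) :
    x ∈ X := by
  obtain ⟨y, hy, hzy⟩ := mem_letters.mp h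
  exact eq_of_mem_att hz hzy ▸ hy

/-- If no bridge of a connected set crosses `B`, then neither does their union: all of them lie
on the same side of a given pair of elements of `B`, as adjacent ones cross each other. -/
lemma not_cross_letters {X : Set ι} (hX : ConnectedIn S.T X) {B : Set V}
    (hB : ∀ x ∈ X, ¬ Cross S.v S.n (S.att x) B) (hd : ∀ x ∈ X, Disjoint (S.att x) B) :
    ¬ Cross S.v S.n (S.letters X) B := by
  rintro ⟨i, j, k, l, h1, h2, h3, h4, hi, hj, hk, hl⟩
  have key : ∀ y ∈ X, ∀ m, j < m → m < l → S.v m ∈ S.att y → S.att y ⊆ arc S.v (j + 1) l := by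
    intro y hy m hm1 hm2 hm z hz
    obtain ⟨m', rfl, hm1', hm2'⟩ := S.cyc.exists_pos (S.att_subset y hz) j
    rcases hm1'.eq_or_lt with rfl | hj'
    · exact absurd hj (Set.disjoint_left.mp (hd y hy) hz)
    rcases lt_trichotomy m' l with hl' | rfl | hl'
    · exact mem_arc (by omega) hl'
    · exact absurd hl (Set.disjoint_left.mp (hd y hy) hz)
    · exact absurd ⟨m, l, m', j + S.n, hm2, hl', hm2', by omega, hm, hl, hz,
        by rwa [S.cyc.periodic]⟩ (hB y hy)
  obtain ⟨x, hx, hix⟩ := mem_letters.mp hi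
  obtain ⟨x', hx', hkx⟩ := mem_letters.mp hk
  have hr := hX x' hx' x hx
  have : S.att x ⊆ arc S.v (j + 1) l := by
    clear hix hx
    induction hr with
    | refl => exact key x' hx' k h2 h3 hkx
    | @tail a b _ hab ih =>
      have hc := (S.adj_iff a b hab.1.ne).mp hab.1
      obtain ⟨a1, b1, a2, e1, e2, e3, e4, -, hb, -⟩ :=
        S.cyc.exists_between_of_cross hc ih (by omega)
      exact key b hab.2 b1 (by omega) (by omega) hb
  obtain ⟨m, ⟨hm1, hm2⟩, hm⟩ := this hix
  have := S.cyc.inj i m hm.symm (by omega) (by omega)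
  omega

lemma letters_disjoint {X Y : Set ι} (h : Disjoint X Y) :
    Disjoint (S.letters X) (S.letters Y) := by
  rw [Set.disjoint_left]
  intro z hz hz'
  obtain ⟨x, hx, hzx⟩ := mem_letters.mp hz
  exact Set.disjoint_left.mp h hx (mem_of_mem_letters hz' hzx)

lemma not_cross_letters_att {X : Set ι} (hX : ConnectedIn S.T X) {y : ι} (hy : y ∉ X)
    (hadj : ∀ x ∈ X, ¬ S.T.Adj x y) : ¬ Cross S.v S.n (S.letters X) (S.att y) :=
  not_cross_letters hX
    (fun x hx h => hadj x hx ((S.adj_iff x y (fun e => hy (e ▸ hx))).mpr h))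
    fun x hx => S.att_disjoint x y (fun e => hy (e ▸ hx))

lemma not_cross_letters_letters {X Y : Set ι} (hX : ConnectedIn S.T X) (hY : ConnectedIn S.T Y)
    (hd : Disjoint X Y) (hadj : ∀ x ∈ X, ∀ y ∈ Y, ¬ S.T.Adj x y) :
    ¬ Cross S.v S.n (S.letters X) (S.letters Y) := by
  intro h
  refine not_cross_letters hY (B := S.letters X) (fun y hy hc => ?_) (fun y hy => ?_)
    (S.cyc.cross_symm h)
  · exact not_cross_letters_att hX (fun hy' => Set.disjoint_left.mp hd hy' hy)
      (fun x hx => hadj x hx y hy) (S.cyc.cross_symm hc)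
  · refine (letters_disjoint hd.symm).mono_left fun z hz => mem_letters_of_mem hy hz

/-- Between two attachments of a branch `D` at `p` that are separated by an attachment of a bridge
outside `D` there is an attachment of `p` itself: otherwise the branch at `p` containing
that bridge would lie between them entirely, and so could not be linked to `p`. -/
lemma exists_mem_att_between {D : Set ι} {c p : ι} (hD : IsBranch S.T D c p) {i k j : ℤ}
    (hik : i < k) (hkj : k < j) (hj : j < i + S.n) (hi : S.v i ∈ S.letters D)
    (hj' : S.v j ∈ S.letters D) {x : ι} (hx : x ∉ D) (hk : S.v k ∈ S.att x) :
    ∃ m, i < m ∧ m < j ∧ S.v m ∈ S.att p := by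
  by_cases hxp : x = p
  · exact ⟨k, hik, hkj, hxp ▸ hk⟩
  obtain ⟨D', c', hD', hx'⟩ := IsBranch.exists_of_isTree S.tree hxp
  have hdisj := hD.disjoint hD' hx' hx
  have hnc := not_cross_letters_letters hD.connected hD'.connected hdisj
    fun x hx y hy => hD.not_adj hD' hdisj hx hy
  have hsub : S.att c' ⊆ arc S.v (i + 1) j := by
    intro z hz
    have hz' := mem_letters_of_mem hD'.mem hz
    obtain ⟨m, rfl, hm1, hm2⟩ := S.cyc.exists_pos (S.att_subset _ hz) i
    rcases hm1.eq_or_lt with rfl | hm1'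
    · exact absurd hz' (Set.disjoint_left.mp (letters_disjoint hdisj) hi)
    rcases lt_trichotomy m j with hl' | rfl | hl'
    · exact mem_arc (by omega) hl'
    · exact absurd hz' (Set.disjoint_left.mp (letters_disjoint hdisj) hj')
    · exact absurd ⟨i, k, j, m, hik, hkj, hl', hm2, hi, mem_letters_of_mem hx' hk, hj', hz'⟩ hnc
  obtain ⟨a, b, a', e1, e2, e3, e4, -, hb, -⟩ := S.cyc.exists_between_of_cross
    ((S.adj_iff _ _ hD'.adj.ne).mp hD'.adj) hsub (by omega)
  exact ⟨b, by omega, by omega, hb⟩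

end BridgeSystem

lemma isPath_append {V : Type*} {G : SimpleGraph V} {x y z : V} {p : G.Walk x y} {q : G.Walk y z}
    (hp : p.IsPath) (hq : q.IsPath) (h : ∀ a ∈ p.support, a ∈ q.support → a = y) :
    (p.append q).IsPath := by
  rw [SimpleGraph.Walk.isPath_def, SimpleGraph.Walk.support_append]
  have hq' := hq.support_nodup
  rw [← SimpleGraph.Walk.cons_tail_support q, List.nodup_cons] at hq'
  refine List.Nodup.append hp.support_nodup hq'.2 ?_
  intro a ha hb
  have := h a ha (List.mem_of_mem_tail hb)
  exact hq'.1 (this ▸ hb)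

lemma HasPath.right_mem {V : Type*} {G : SimpleGraph V} {W : Set V} {x y : V} {l : ℤ}
    (h : HasPath G W x y l) : y ∈ W := by
  obtain ⟨w, -, h2, -⟩ := h
  exact h2 y w.end_mem_support

namespace BridgeSystem

variable {V ι : Type*} {G : SimpleGraph V} {S : BridgeSystem G ι}

/-- Joining two disjoint paths that end in attachments of a bridge `x` by a path through `x`. -/
lemma hasPath_jump {W W' : Set V} {y z a b : V} {l l' : ℤ} {x : ι} (h : HasPath G W y a l)
    (h' : HasPath G W' z b l') (ha : a ∈ S.att x) (hb : b ∈ S.att x) (hd : Disjoint W W')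
    (hW : Disjoint (S.inner x) W) (hW' : Disjoint (S.inner x) W') :
    HasPath G (W ∪ W' ∪ S.inner x) y z
      (l + l' + ∑ e ∈ S.cuts x, (sep (S.side x e) a b : ℤ) - 1) := by
  have haW := h.right_mem
  have hbW := h'.right_mem
  have hab : a ≠ b := fun e => Set.disjoint_left.mp hd haW (e ▸ hbW)
  obtain ⟨w, hw1, hw2, hw3⟩ := S.jump x a ha b hb hab
  obtain ⟨p, hp1, hp2, hp3⟩ := h
  obtain ⟨q, hq1, hq2, hq3⟩ := h'
  have hwq : (w.append q.reverse).IsPath := by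
    refine isPath_append hw1 hq1.reverse fun u hu hu' => ?_
    have hu'' := hq2 u (by simpa using hu')
    rcases hw2 u hu with rfl | rfl | hu
    · exact absurd hu'' (Set.disjoint_left.mp hd haW)
    · rfl
    · exact absurd hu'' (Set.disjoint_left.mp hW' hu)
  refine ⟨p.append (w.append q.reverse), isPath_append hp1 hwq fun u hu hu' => ?_, ?_, ?_⟩
  · have hu'' := hp2 u hu
    rw [SimpleGraph.Walk.mem_support_append_iff] at hu'
    rcases hu' with hu' | hu'
    · rcases hw2 u hu' with rfl | rfl | hu'
      · rfl
      · exact absurd hbW (Set.disjoint_left.mp hd hu'')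
      · exact absurd hu'' (Set.disjoint_left.mp hW hu')
    · exact absurd (hq2 u (by simpa using hu')) (Set.disjoint_left.mp hd hu'')
  · intro u hu
    simp only [SimpleGraph.Walk.mem_support_append_iff, SimpleGraph.Walk.support_reverse,
      List.mem_reverse] at hu
    rcases hu with hu | hu | hu
    · exact .inl (.inl (hp2 u hu))
    · rcases hw2 u hu with rfl | rfl | hu
      · exact .inl (.inl haW)
      · exact .inl (.inr hbW)
      · exact .inr hu
    · exact .inl (.inr (hq2 u hu))
  · simp only [SimpleGraph.Walk.length_append, SimpleGraph.Walk.length_reverse]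
    have : (∑ e ∈ S.cuts x, (sep (S.side x e) a b : ℤ)) ≤ w.length := by exact_mod_cast hw3
    push_cast
    linarith

/-! ### Intervals of the cycle -/

lemma inner_disjoint_arc {x : ι} {s t : ℤ} : Disjoint (S.inner x) (arc S.v s t) :=
  (S.inner_off x).mono_right (Set.image_subset_range _ _)

variable [Fintype ι]

open Classical in
/-- The bridges other than `p` that have an attachment at one of the positions `s, …, t - 1`. -/
noncomputable def others (S : BridgeSystem G ι) (p : ι) (s t : ℤ) : Finset ι :=
  Finset.univ.filter fun x => x ≠ p ∧ ∃ z ∈ S.att x, z ∈ arc S.v s t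

/-- The vertices at the positions `s, …, t - 1` together with the inner vertices of the bridges
other than `p` that are attached there. -/
def region (S : BridgeSystem G ι) (p : ι) (s t : ℤ) : Set V :=
  arc S.v s t ∪ ⋃ x ∈ S.others p s t, S.inner x

/-- Bridges other than `p` with an attachment at the positions `s, …, t - 1` have all their
attachments there. -/
def IsWhole (S : BridgeSystem G ι) (p : ι) (s t : ℤ) : Prop :=
  ∀ x ≠ p, ∀ z ∈ S.att x, z ∈ arc S.v s t → S.att x ⊆ arc S.v s t

lemma mem_others {p x : ι} {s t : ℤ} :
    x ∈ S.others p s t ↔ x ≠ p ∧ ∃ z ∈ S.att x, z ∈ arc S.v s t := by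
  simp [others]

lemma arc_subset_region {p : ι} {s t : ℤ} : arc S.v s t ⊆ S.region p s t :=
  Set.subset_union_left

lemma others_mono {p : ι} {s t s' t' : ℤ} (h : arc S.v s t ⊆ arc S.v s' t') :
    S.others p s t ⊆ S.others p s' t' := by
  intro x hx
  rw [mem_others] at hx ⊢
  exact ⟨hx.1, hx.2.imp fun z hz => ⟨hz.1, h hz.2⟩⟩

lemma region_subset {p p' : ι} {s t s' t' : ℤ} (h : arc S.v s t ⊆ arc S.v s' t')
    (h' : S.others p s t ⊆ S.others p' s' t') : S.region p s t ⊆ S.region p' s' t' :=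
  Set.union_subset_union h (Set.biUnion_subset_biUnion_left h')

lemma region_mono {p : ι} {s t s' t' : ℤ} (h : arc S.v s t ⊆ arc S.v s' t') :
    S.region p s t ⊆ S.region p s' t' :=
  region_subset h (others_mono h)

lemma region_disjoint_arc {p : ι} {s t s' t' : ℤ} (h : Disjoint (arc S.v s t) (arc S.v s' t')) :
    Disjoint (S.region p s t) (arc S.v s' t') := by
  rw [region, Set.disjoint_union_left]
  refine ⟨h, ?_⟩
  simp only [Set.disjoint_iUnion_left]
  exact fun x _ => inner_disjoint_arc

lemma inner_disjoint_region {p x : ι} {s t : ℤ} (h : x ∉ S.others p s t) :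
    Disjoint (S.inner x) (S.region p s t) := by
  rw [region, Set.disjoint_union_right]
  refine ⟨inner_disjoint_arc, ?_⟩
  simp only [Set.disjoint_iUnion_right]
  exact fun y hy => S.inner_disjoint x y fun e => h (e ▸ hy)

lemma notMem_others_self {p : ι} {s t : ℤ} : p ∉ S.others p s t := fun h => (mem_others.mp h).1 rfl

lemma region_disjoint_region {p p' : ι} {s t s' t' : ℤ}
    (h : Disjoint (arc S.v s t) (arc S.v s' t')) (hw : S.IsWhole p s t) :
    Disjoint (S.region p s t) (S.region p' s' t') := by
  rw [region.eq_def S p' s' t', Set.disjoint_union_right]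
  refine ⟨region_disjoint_arc h, ?_⟩
  simp only [Set.disjoint_iUnion_right]
  intro x hx
  refine (inner_disjoint_region fun hx' => ?_).symm
  obtain ⟨z, hz, hz'⟩ := (mem_others.mp hx).2
  obtain ⟨hxp, y, hy, hy'⟩ := mem_others.mp hx'
  exact Set.disjoint_left.mp h (hw x hxp y hy hy' hz) hz'

/-! ### Tracing an interval -/

/-- Ends and excesses of four paths through an interval of positions, together with a function
counting the pairs separated by a cut; see `IsTraced`. -/
structure Traces (V : Type*) where
  /-- the ends of the paths from the first vertex -/
  fwd : Bool → V
  /-- the ends of the paths from the last vertex -/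
  bwd : Bool → V
  /-- the excess of the paths from the first vertex -/
  fwdEx : Bool → ℤ
  /-- the excess of the paths from the last vertex -/
  bwdEx : Bool → ℤ
  /-- the number of joined pairs separated by a cut -/
  cr : (V → Bool) → ℕ

/-- Paths through the interval `s, …, t - 1` of positions, with the bookkeeping needed to combine
them. For `b : Bool`, the path `fwd_path b` leads from the first vertex of the interval to an
attachment `d.fwd b` of the bridge `p`, the path `bwd_path b` leads there from the last vertex to
`d.bwd b`, and `d.fwdEx b`, `d.bwdEx b` are their numbers of vertices in excess of `t - s`. Such a
path arises from the interval by leaving out pieces of the cycle and inserting paths through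
the bridges of `others p s t`. In addition, some pairs of attachments of `p` have been
joined within the interval by exchanges that close up to cycles, and `d.cr φ` is
the number of these pairs separated by `φ`. The inequality `bound` adds up what these cycles give,
each piece of the cycle being left out twice overall, and `fourCut` says
that the pairs and the four path ends link the attachments of `p` in a `4`-edge-connected way. -/
structure IsTraced (S : BridgeSystem G ι) (p : ι) (s t : ℤ) (d : Traces V) : Prop where
  fwd_path : ∀ b, HasPath G (S.region p s t) (S.v s) (d.fwd b) (t - s + d.fwdEx b)
  bwd_path : ∀ b, HasPath G (S.region p s t) (S.v (t - 1)) (d.bwd b) (t - s + d.bwdEx b)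
  bound : 4 * ∑ x ∈ S.others p s t, ((S.cuts x).card : ℤ) +
      ∑ e ∈ S.cuts p, (d.cr (S.side p e) : ℤ) ≤
    2 * (t - s) - 2 + d.fwdEx true + d.fwdEx false + d.bwdEx true + d.bwdEx false
  fourCut : ∀ φ, IsFourCut φ (S.att p ∩ arc S.v s t) (d.cr φ) (d.bwd true) (d.bwd false)
    (d.fwd true) (d.fwd false)

namespace IsTraced

variable {p : ι} {s t r : ℤ} {d d' : Traces V}

lemma fwd_mem (h : S.IsTraced p s t d) (b : Bool) : d.fwd b ∈ S.att p := by
  cases b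
  · exact (h.fourCut fun _ => true).mem₄.1
  · exact (h.fourCut fun _ => true).mem₃.1

lemma bwd_mem (h : S.IsTraced p s t d) (b : Bool) : d.bwd b ∈ S.att p := by
  cases b
  · exact (h.fourCut fun _ => true).mem₂.1
  · exact (h.fourCut fun _ => true).mem₁.1

/-- The interval consisting of a single attachment of `p`. -/
lemma exists_single (h : S.v s ∈ S.att p) : ∃ d, S.IsTraced p s (s + 1) d := by
  have harc : arc S.v s (s + 1) = {S.v s} := by
    ext z
    constructor
    · rintro ⟨i, ⟨h1, h2⟩, rfl⟩
      rw [show i = s by omega]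
      rfl
    · rintro rfl
      exact mem_arc le_rfl (by omega)
  have hoth : S.others p s (s + 1) = ∅ := by
    ext x
    simp only [mem_others, harc, Finset.notMem_empty, iff_false, not_and, not_exists]
    rintro hx z hz rfl
    exact hx (eq_of_mem_att hz h)
  refine ⟨⟨fun _ => S.v s, fun _ => S.v s, fun _ => 0, fun _ => 0, fun _ => 0⟩, fun _ => ?_,
    fun _ => ?_, ?_, fun φ => ?_⟩
  · exact (HasPath.refl (arc_subset_region (mem_arc le_rfl (by omega)))).mono subset_rfl
      (by dsimp only; omega)
  · rw [show s + 1 - 1 = s by ring]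
    exact (HasPath.refl (arc_subset_region (mem_arc le_rfl (by omega)))).mono subset_rfl
      (by dsimp only; omega)
  · simp [hoth]
  · rw [harc, Set.inter_eq_self_of_subset_right (by simpa using h)]
    exact .singleton _

/-- A vertex that is no attachment may be appended to an interval. -/
lemma exists_succ (h : S.IsTraced p s t d) (hst : s < t) (htn : t < s + S.n)
    (ht : ∀ x, S.v t ∉ S.att x) : ∃ d, S.IsTraced p s (t + 1) d := by
  have harc : arc S.v s (t + 1) = arc S.v t (t + 1) ∪ arc S.v s t := by
    rw [Set.union_comm, arc_union hst.le (by omega)]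
  have hsub : arc S.v s t ⊆ arc S.v s (t + 1) := arc_mono le_rfl (by omega)
  have hmem : ∀ x, ∀ z ∈ S.att x, z ∈ arc S.v s (t + 1) → z ∈ arc S.v s t := by
    rintro x z hz ⟨i, ⟨hi1, hi2⟩, rfl⟩
    rcases (show i ≤ t by omega).eq_or_lt with rfl | hi
    · exact absurd hz (ht x)
    · exact mem_arc hi1 hi
  have hoth : S.others p s (t + 1) = S.others p s t := by
    refine subset_antisymm (fun x hx => ?_) (others_mono hsub)
    obtain ⟨h1, z, hz, hz'⟩ := mem_others.mp hx
    exact mem_others.mpr ⟨h1, z, hz, hmem x z hz hz'⟩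
  have hatt : S.att p ∩ arc S.v s (t + 1) = S.att p ∩ arc S.v s t :=
    subset_antisymm (fun z hz => ⟨hz.1, hmem p z hz.1 hz.2⟩)
      (Set.inter_subset_inter_right _ hsub)
  refine ⟨⟨d.fwd, d.bwd, fun b => d.fwdEx b - 1, d.bwdEx, d.cr⟩, fun b => ?_, fun b => ?_, ?_,
    fun φ => hatt ▸ h.fourCut φ⟩
  · exact (h.fwd_path b).mono (region_mono hsub) (by dsimp only; omega)
  · refine (S.cyc.hasPath_arc_append_rev (s := t) (t := t + 1) (h.bwd_path b) (by omega)
      (by have := S.cyc.three_le; omega) ?_).mono ?_ (by dsimp only; omega)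
    · exact (region_disjoint_arc (S.cyc.arc_disjoint le_rfl (by omega))).symm
    · exact Set.union_subset ((arc_mono hst.le le_rfl).trans arc_subset_region) (region_mono hsub)
  · rw [hoth]
    have := h.bound
    linarith

/-- Concatenation of two intervals: a path from the first vertex of the first and a path from the
last vertex of the second are joined through `p` and so close up to a cycle. -/
lemma exists_append (h : S.IsTraced p s r d) (h' : S.IsTraced p r t d') (hsr : s < r)
    (hrt : r < t) (htn : t ≤ s + S.n) (hw : S.IsWhole p s r) :
    ∃ d, S.IsTraced p s t d := by
  have hsub : arc S.v s r ⊆ arc S.v s t := arc_mono le_rfl hrt.le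
  have hsub' : arc S.v r t ⊆ arc S.v s t := arc_mono hsr.le le_rfl
  have hdisj : Disjoint (arc S.v s r) (arc S.v r t) := S.cyc.arc_disjoint le_rfl htn
  have hjump : ∀ b, d.fwdEx b + d'.bwdEx b +
      ∑ e ∈ S.cuts p, (sep (S.side p e) (d.fwd b) (d'.bwd b) : ℤ) ≤ 1 := by
    intro b
    have hj := hasPath_jump (h.fwd_path b) (h'.bwd_path b) (h.fwd_mem b) (h'.bwd_mem b)
      (region_disjoint_region hdisj hw) (inner_disjoint_region notMem_others_self)
      (inner_disjoint_region notMem_others_self)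
    have := S.cyc.le_of_hasPath hj (by omega) htn (by
      rw [Set.disjoint_union_left, Set.disjoint_union_left]
      refine ⟨⟨region_disjoint_arc ?_, region_disjoint_arc ?_⟩, inner_disjoint_arc⟩
      · exact S.cyc.arc_disjoint hrt.le (by omega)
      · exact S.cyc.arc_disjoint le_rfl (by omega))
    linarith
  refine ⟨⟨d'.fwd, d.bwd, d'.fwdEx, d.bwdEx, fun φ => d.cr φ + d'.cr φ +
    sep φ (d.fwd true) (d'.bwd true) + sep φ (d.fwd false) (d'.bwd false)⟩, fun b => ?_,
    fun b => ?_, ?_, fun φ => ?_⟩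
  · refine (S.cyc.hasPath_arc_append (s := s) (h'.fwd_path b) hsr.le (by omega) ?_).mono ?_
      (by dsimp only; omega)
    · exact (region_disjoint_arc hdisj.symm).symm
    · exact Set.union_subset (hsub.trans arc_subset_region) (region_mono hsub')
  · refine (S.cyc.hasPath_arc_append_rev (t := t) (h.bwd_path b) hrt.le (by omega) ?_).mono ?_
      (by dsimp only; omega)
    · exact (region_disjoint_arc hdisj).symm
    · exact Set.union_subset (hsub'.trans arc_subset_region) (region_mono hsub)
  · classical
    have hoth : S.others p s t ⊆ S.others p s r ∪ S.others p r t := by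
      intro x hx
      obtain ⟨h1, z, hz, hz'⟩ := mem_others.mp hx
      rw [← arc_union hsr.le hrt.le] at hz'
      rw [Finset.mem_union, mem_others, mem_others]
      exact hz'.imp (fun hz' => ⟨h1, z, hz, hz'⟩) fun hz' => ⟨h1, z, hz, hz'⟩
    have h1 : ∑ x ∈ S.others p s t, ((S.cuts x).card : ℤ) ≤
        ∑ x ∈ S.others p s r, ((S.cuts x).card : ℤ) +
          ∑ x ∈ S.others p r t, ((S.cuts x).card : ℤ) := by
      rw [← Finset.sum_union_inter]
      have := Finset.sum_le_sum_of_subset_of_nonneg hoth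
        (f := fun x => ((S.cuts x).card : ℤ)) fun _ _ _ => by positivity
      have : 0 ≤ ∑ x ∈ S.others p s r ∩ S.others p r t, ((S.cuts x).card : ℤ) := by positivity
      linarith
    push_cast
    simp only [Finset.sum_add_distrib]
    have := h.bound
    have := h'.bound
    have := hjump true
    have := hjump false
    linarith
  · rw [← arc_union hsr.le hrt.le, Set.inter_union_distrib_left]
    exact (h.fourCut φ).merge (h'.fourCut φ)

end IsTraced

end BridgeSystem

/-! ### Joining traced intervals -/

lemma sum_range_cyclic (f g : ℕ → ℤ) (m : ℕ) :
    ∑ i ∈ Finset.range (m + 1), (f i + g i) =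
      ∑ i ∈ Finset.range m, (f i + g (i + 1)) + (f m + g 0) := by
  rw [Finset.sum_add_distrib, Finset.sum_add_distrib, Finset.sum_range_succ f,
    Finset.sum_range_succ' g]
  ring

lemma IsFourCut.swap {V : Type*} {φ : V → Bool} {S : Set V} {c : ℕ} {x₁ x₂ y₁ y₂ : V}
    (h : IsFourCut φ S c x₁ x₂ y₁ y₂) : IsFourCut φ S c y₁ x₁ y₂ x₂ :=
  ⟨h.mem₃, h.mem₁, h.mem₄, h.mem₂, fun τ => (h.four_le τ).imp id fun _ => by omega⟩

namespace BridgeSystem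

variable {V ι : Type*} {G : SimpleGraph V} {S : BridgeSystem G ι}

/-- The excess of the path that joins the first vertices of two intervals with root `c` by a path
through `c`. -/
def fwdJoin (S : BridgeSystem G ι) (c : ι) (d d' : Traces V) : ℤ :=
  d.fwdEx false + d'.fwdEx true +
    ∑ e ∈ S.cuts c, (sep (S.side c e) (d.fwd false) (d'.fwd true) : ℤ) - 1

/-- The excess of the path that joins the last vertices of two intervals with root `c` by a path
through `c`. -/
def bwdJoin (S : BridgeSystem G ι) (c : ι) (d d' : Traces V) : ℤ :=
  d.bwdEx false + d'.bwdEx true +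
    ∑ e ∈ S.cuts c, (sep (S.side c e) (d.bwd false) (d'.bwd true) : ℤ) - 1

variable [Fintype ι]

/-- The vertices available to the paths joining two intervals with root `c`. -/
def joinRegion (S : BridgeSystem G ι) (c : ι) (s t s' t' : ℤ) : Set V :=
  S.region c s t ∪ S.region c s' t' ∪ S.inner c

namespace IsTraced

variable {c : ι} {s t s' t' : ℤ} {d d' : Traces V}

lemma fwdJoin_path (h : S.IsTraced c s t d) (h' : S.IsTraced c s' t' d')
    (hd : Disjoint (arc S.v s t) (arc S.v s' t')) (hw : S.IsWhole c s t) :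
    HasPath G (S.joinRegion c s t s' t') (S.v s) (S.v s')
      (t - s + (t' - s') + S.fwdJoin c d d') :=
  (hasPath_jump (h.fwd_path false) (h'.fwd_path true) (h.fwd_mem _) (h'.fwd_mem _)
    (region_disjoint_region hd hw) (inner_disjoint_region notMem_others_self)
    (inner_disjoint_region notMem_others_self)).mono subset_rfl (by unfold fwdJoin; linarith)

lemma bwdJoin_path (h : S.IsTraced c s t d) (h' : S.IsTraced c s' t' d')
    (hd : Disjoint (arc S.v s t) (arc S.v s' t')) (hw : S.IsWhole c s t) :
    HasPath G (S.joinRegion c s t s' t') (S.v (t - 1)) (S.v (t' - 1))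
      (t - s + (t' - s') + S.bwdJoin c d d') :=
  (hasPath_jump (h.bwd_path false) (h'.bwd_path true) (h.bwd_mem _) (h'.bwd_mem _)
    (region_disjoint_region hd hw) (inner_disjoint_region notMem_others_self)
    (inner_disjoint_region notMem_others_self)).mono subset_rfl (by unfold bwdJoin; linarith)

end IsTraced

/-- Let all attachments of `c` lie in a family of at least two intervals with root `c`. If each
interval is joined cyclically to the next one, by a path between the first vertices and another one
between the last vertices, then the excesses of these paths account for the lengths of `c`
and of all bridges attached inside the intervals. -/
lemma four_mul_card_le_sum_join {c : ι} {q u : ℕ → ℤ} {d : ℕ → Traces V} {m : ℕ} (hm : 1 ≤ m)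
    (h : ∀ i ≤ m, S.IsTraced c (q i) (u i) (d i))
    (hcov : S.att c ⊆ ⋃ i ≤ m, arc S.v (q i) (u i)) :
    4 * ((S.cuts c).card +
      ∑ i ∈ Finset.range (m + 1), ∑ x ∈ S.others c (q i) (u i), ((S.cuts x).card : ℤ)) ≤
    2 * ∑ i ∈ Finset.range (m + 1), (u i - q i) +
      (∑ i ∈ Finset.range m, S.fwdJoin c (d i) (d (i + 1)) + S.fwdJoin c (d m) (d 0)) +
      (∑ i ∈ Finset.range m, S.bwdJoin c (d i) (d (i + 1)) + S.bwdJoin c (d m) (d 0)) := by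
  have hcut : ∀ e ∈ S.cuts c, (4 : ℤ) ≤
      ∑ i ∈ Finset.range (m + 1), ((d i).cr (S.side c e) : ℤ) +
      (∑ i ∈ Finset.range m, (sep (S.side c e) ((d i).fwd false) ((d (i + 1)).fwd true) : ℤ) +
        sep (S.side c e) ((d m).fwd false) ((d 0).fwd true)) +
      (∑ i ∈ Finset.range m, (sep (S.side c e) ((d i).bwd false) ((d (i + 1)).bwd true) : ℤ) +
        sep (S.side c e) ((d m).bwd false) ((d 0).bwd true)) := by
    intro e he
    have h4 := IsFourCut.cycle hm (fun i hi => ((h i hi).fourCut (S.side c e)).swap) (by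
      obtain ⟨a, ha, b, hb, hab⟩ := S.side_ne c e he
      have hmem : ∀ z ∈ S.att c, z ∈ ⋃ i ≤ m, S.att c ∩ arc S.v (q i) (u i) := by
        intro z hz
        have := hcov hz
        simp only [Set.mem_iUnion, Set.mem_inter_iff] at this ⊢
        obtain ⟨i, hi, hz'⟩ := this
        exact ⟨i, hi, hz, hz'⟩
      exact ⟨a, hmem a ha, b, hmem b hb, hab⟩)
    exact_mod_cast h4
  have hsum := Finset.sum_le_sum hcut
  simp only [Finset.sum_const, Finset.sum_add_distrib, nsmul_eq_mul] at hsum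
  rw [Finset.sum_comm (s := S.cuts c), Finset.sum_comm (s := S.cuts c) (t := Finset.range m),
    Finset.sum_comm (s := S.cuts c) (t := Finset.range m)] at hsum
  have hb := Finset.sum_le_sum fun i (hi : i ∈ Finset.range (m + 1)) =>
    (h i (by rw [Finset.mem_range] at hi; omega)).bound
  have e1 := sum_range_cyclic (fun i => (d i).fwdEx false) (fun i => (d i).fwdEx true) m
  have e2 := sum_range_cyclic (fun i => (d i).bwdEx false) (fun i => (d i).bwdEx true) m
  simp only [fwdJoin, bwdJoin]
  simp only [Finset.sum_add_distrib, Finset.sum_sub_distrib, ← Finset.mul_sum, Finset.sum_const,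
    Finset.card_range, nsmul_eq_mul] at hb e1 e2 ⊢
  push_cast at hb e1 e2 ⊢
  linarith

end BridgeSystem

/-! ### Alternating intervals -/

lemma sum_alternating (q u : ℕ → ℤ) (m : ℕ) : ∑ i ∈ Finset.range (m + 2), (u i - q i) +
    ∑ i ∈ Finset.range (m + 1), (q (i + 1) - u i) = u (m + 1) - q 0 := by
  rw [Finset.sum_range_succ]
  induction m with
  | zero =>
    simp only [zero_add, Finset.sum_range_one]
    ring
  | succ m ih =>
    rw [Finset.sum_range_succ, Finset.sum_range_succ _ (m + 1)]
    linarith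

/-- Every position belongs to one of the alternating intervals. -/
lemma exists_of_mem_arc {V : Type*} {v : ℤ → V} {q u : ℕ → ℤ} {m : ℕ} {z : V}
    (hz : z ∈ arc v (q 0) (u (m + 1))) :
    (∃ i ≤ m + 1, z ∈ arc v (q i) (u i)) ∨ ∃ i ≤ m, z ∈ arc v (u i) (q (i + 1)) := by
  obtain ⟨k, ⟨hk1, hk2⟩, rfl⟩ := hz
  have key : ∀ j ≤ m + 1, k < u j →
      (∃ i ≤ m + 1, v k ∈ arc v (q i) (u i)) ∨
        ∃ i ≤ m, v k ∈ arc v (u i) (q (i + 1)) := by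
    intro j
    induction j with
    | zero => exact fun _ hj => .inl ⟨0, by omega, mem_arc hk1 hj⟩
    | succ j ih =>
      intro hj hk
      by_cases h1 : k < u j
      · exact ih (by omega) h1
      by_cases h2 : k < q (j + 1)
      · exact .inr ⟨j, by omega, mem_arc (by omega) h2⟩
      · exact .inl ⟨j + 1, hj, mem_arc (by omega) hk⟩
  exact key (m + 1) le_rfl hk2

namespace BridgeSystem

variable {V ι : Type*} {G : SimpleGraph V} {S : BridgeSystem G ι} [Fintype ι]

lemma joinRegion_disjoint_arc {c : ι} {s t s' t' a b : ℤ}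
    (h1 : Disjoint (arc S.v s t) (arc S.v a b))
    (h2 : Disjoint (arc S.v s' t') (arc S.v a b)) :
    Disjoint (S.joinRegion c s t s' t') (arc S.v a b) := by
  rw [joinRegion, Set.disjoint_union_left, Set.disjoint_union_left]
  exact ⟨⟨region_disjoint_arc h1, region_disjoint_arc h2⟩, inner_disjoint_arc⟩

lemma sum_others_le (S : BridgeSystem G ι) (c p : ι) (q u : ℕ → ℤ) (m : ℕ) :
    ∑ x ∈ S.others p (q 0) (u (m + 1)), ((S.cuts x).card : ℤ) ≤
    (S.cuts c).card +
      ∑ i ∈ Finset.range (m + 2), ∑ x ∈ S.others c (q i) (u i), ((S.cuts x).card : ℤ) +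
      ∑ i ∈ Finset.range (m + 1), ∑ x ∈ S.others p (u i) (q (i + 1)), ((S.cuts x).card : ℤ) := by
  classical
  have hsub : S.others p (q 0) (u (m + 1)) ⊆ ({c} ∪
      (Finset.range (m + 2)).biUnion fun i => S.others c (q i) (u i)) ∪
      (Finset.range (m + 1)).biUnion fun i => S.others p (u i) (q (i + 1)) := by
    intro x hx
    obtain ⟨hxp, z, hz, hz'⟩ := mem_others.mp hx
    simp only [Finset.mem_union, Finset.mem_singleton, Finset.mem_biUnion, Finset.mem_range]
    by_cases hxc : x = c
    · exact .inl (.inl hxc)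
    rcases exists_of_mem_arc hz' with ⟨i, hi, hz'⟩ | ⟨i, hi, hz'⟩
    · exact .inl (.inr ⟨i, by omega, mem_others.mpr ⟨hxc, z, hz, hz'⟩⟩)
    · exact .inr ⟨i, by omega, mem_others.mpr ⟨hxp, z, hz, hz'⟩⟩
  have hun : ∀ A B : Finset ι, ∑ x ∈ A ∪ B, (S.cuts x).card ≤
      ∑ x ∈ A, (S.cuts x).card + ∑ x ∈ B, (S.cuts x).card := fun A B => by
    rw [← Finset.sum_union_inter]
    exact Nat.le_add_right _ _
  have hbi : ∀ (A : ℕ → Finset ι) (k : ℕ), ∑ x ∈ (Finset.range k).biUnion A, (S.cuts x).card ≤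
      ∑ i ∈ Finset.range k, ∑ x ∈ A i, (S.cuts x).card := by
    intro A k
    induction k with
    | zero => simp
    | succ k ih =>
      rw [Finset.range_add_one, Finset.biUnion_insert, Finset.sum_insert (by simp)]
      exact (hun _ _).trans (Nat.add_le_add_left ih _)
  have h1 := Finset.sum_le_sum_of_subset (f := fun x => (S.cuts x).card) hsub
  have h2 := hun ({c} ∪ (Finset.range (m + 2)).biUnion fun i => S.others c (q i) (u i))
    ((Finset.range (m + 1)).biUnion fun i => S.others p (u i) (q (i + 1)))
  have h3 := hun {c} ((Finset.range (m + 2)).biUnion fun i => S.others c (q i) (u i))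
  have h4 := hbi (fun i => S.others c (q i) (u i)) (m + 2)
  have h5 := hbi (fun i => S.others p (u i) (q (i + 1))) (m + 1)
  rw [Finset.sum_singleton] at h3
  exact_mod_cast h1.trans (h2.trans (Nat.add_le_add (h3.trans (Nat.add_le_add_left h4 _)) h5))

/-- Intervals `Q i = [q i, u i)`, `i ≤ m + 1`, alternate with intervals `P i = [u i, q (i + 1))`,
`i ≤ m`. The attachments of `c` lie in the former and those of `p` in the latter, and all
further bridges attached in one of these intervals have all their attachments there. -/
structure IsAlternating (S : BridgeSystem G ι) (c p : ι) (q u : ℕ → ℤ) (m : ℕ) : Prop where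
  lt : ∀ i ≤ m + 1, q i < u i
  lt' : ∀ i ≤ m, u i < q (i + 1)
  le : u (m + 1) ≤ q 0 + S.n
  whole : ∀ i ≤ m + 1, S.IsWhole c (q i) (u i)
  whole' : ∀ i ≤ m, S.IsWhole p (u i) (q (i + 1))
  notMem : ∀ i ≤ m + 1, p ∉ S.others c (q i) (u i)
  notMem' : ∀ i ≤ m, c ∉ S.others p (u i) (q (i + 1))
  ne : c ≠ p
  cover : S.att c ⊆ arc S.v (q 0) (u (m + 1))
  mem : c ∈ S.others p (q 0) (u (m + 1))

namespace IsAlternating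

variable {c p : ι} {q u : ℕ → ℤ} {m : ℕ} (h : S.IsAlternating c p q u m)
include h

lemma q_le_q {i j : ℕ} (hij : i ≤ j) (hj : j ≤ m + 1) : q i ≤ q j := by
  induction j, hij using Nat.le_induction with
  | base => exact le_rfl
  | succ j _ ih =>
    have := ih (by omega)
    have := h.lt j (by omega)
    have := h.lt' j (by omega)
    omega

lemma u_lt_q {i j : ℕ} (hij : i < j) (hj : j ≤ m + 1) : u i < q j := by
  have := h.lt' i (by omega)
  have := h.q_le_q (i := i + 1) (j := j) (by omega) hj
  omega

lemma u_le_u {i j : ℕ} (hij : i ≤ j) (hj : j ≤ m + 1) : u i ≤ u j := by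
  rcases hij.eq_or_lt with rfl | hij
  · exact le_rfl
  · have := h.u_lt_q hij hj
    have := h.lt j hj
    omega

lemma cover_Q : S.att c ⊆ ⋃ i ≤ m + 1, arc S.v (q i) (u i) := by
  intro z hz
  simp only [Set.mem_iUnion]
  rcases exists_of_mem_arc (h.cover hz) with ⟨i, hi, hz'⟩ | ⟨i, hi, hz'⟩
  · exact ⟨i, hi, hz'⟩
  · exact absurd (mem_others.mpr ⟨h.ne, z, hz, hz'⟩) (h.notMem' i hi)

lemma arc_Q_subset {i : ℕ} (hi : i ≤ m + 1) :
    arc S.v (q i) (u i) ⊆ arc S.v (q 0) (u (m + 1)) :=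
  arc_mono (h.q_le_q (by omega) hi) (h.u_le_u hi le_rfl)

lemma arc_P_subset {i : ℕ} (hi : i ≤ m) :
    arc S.v (u i) (q (i + 1)) ⊆ arc S.v (q 0) (u (m + 1)) :=
  arc_mono (by have := h.lt 0 (by omega); have := h.u_le_u (i := 0) (j := i); omega)
    (by have := h.lt (i + 1) (by omega); have := h.u_le_u (i := i + 1) (j := m + 1); omega)

lemma cover_P : S.att p ∩ arc S.v (q 0) (u (m + 1)) =
    ⋃ i ≤ m, S.att p ∩ arc S.v (u i) (q (i + 1)) := by
  ext z
  simp only [Set.mem_iUnion, Set.mem_inter_iff]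
  constructor
  · rintro ⟨hz, hz'⟩
    rcases exists_of_mem_arc hz' with ⟨i, hi, hz'⟩ | ⟨i, hi, hz'⟩
    · exact absurd (mem_others.mpr ⟨h.ne.symm, z, hz, hz'⟩) (h.notMem i hi)
    · exact ⟨i, hi, hz, hz'⟩
  · rintro ⟨i, hi, hz, hz'⟩
    exact ⟨hz, h.arc_P_subset hi hz'⟩

lemma region_Q_subset {i : ℕ} (hi : i ≤ m + 1) :
    S.region c (q i) (u i) ⊆ S.region p (q 0) (u (m + 1)) := by
  refine region_subset (h.arc_Q_subset hi) fun x hx => ?_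
  obtain ⟨-, z, hz, hz'⟩ := mem_others.mp hx
  exact mem_others.mpr ⟨fun e => h.notMem i hi (e ▸ hx), z, hz, h.arc_Q_subset hi hz'⟩

lemma region_P_subset {i : ℕ} (hi : i ≤ m) :
    S.region p (u i) (q (i + 1)) ⊆ S.region p (q 0) (u (m + 1)) :=
  region_mono (h.arc_P_subset hi)

lemma inner_subset : S.inner c ⊆ S.region p (q 0) (u (m + 1)) :=
  (Set.subset_biUnion_of_mem (u := fun x => S.inner x) h.mem).trans Set.subset_union_right

lemma joinRegion_subset {i j : ℕ} (hi : i ≤ m + 1) (hj : j ≤ m + 1) :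
    S.joinRegion c (q i) (u i) (q j) (u j) ⊆ S.region p (q 0) (u (m + 1)) :=
  Set.union_subset (Set.union_subset (h.region_Q_subset hi) (h.region_Q_subset hj)) h.inner_subset

lemma arc_QQ_disjoint {i j : ℕ} (hi : i ≤ m + 1) (hj : j ≤ m + 1) (hij : i ≠ j) :
    Disjoint (arc S.v (q i) (u i)) (arc S.v (q j) (u j)) := by
  wlog hlt : i < j generalizing i j
  · exact (this hj hi hij.symm (by omega)).symm
  refine S.cyc.arc_disjoint (h.u_lt_q hlt hj).le ?_
  have := h.le
  have := h.u_le_u hj le_rfl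
  have := h.q_le_q (Nat.zero_le i) hi
  omega

lemma arc_PP_disjoint {i j : ℕ} (hi : i ≤ m) (hj : j ≤ m) (hij : i ≠ j) :
    Disjoint (arc S.v (u i) (q (i + 1))) (arc S.v (u j) (q (j + 1))) := by
  wlog hlt : i < j generalizing i j
  · exact (this hj hi hij.symm (by omega)).symm
  refine S.cyc.arc_disjoint ?_ ?_
  · have := h.q_le_q (i := i + 1) (j := j) hlt (by omega)
    have := h.lt j (by omega)
    omega
  · have := h.le
    have := h.lt (j + 1) (by omega)
    have := h.u_le_u (i := j + 1) (j := m + 1) (by omega) le_rfl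
    have := h.q_le_q (Nat.zero_le i) (by omega)
    have := h.lt i (by omega)
    omega

lemma arc_QP_disjoint {i j : ℕ} (hi : i ≤ m + 1) (hj : j ≤ m) :
    Disjoint (arc S.v (q i) (u i)) (arc S.v (u j) (q (j + 1))) := by
  have h1 := h.le
  have h2 := h.lt i hi
  have h3 := h.lt j (by omega)
  have h4 := h.lt (j + 1) (by omega)
  rcases le_or_gt i j with hij | hij
  · refine S.cyc.arc_disjoint (h.u_le_u hij (by omega)) ?_
    have := h.u_le_u (i := j + 1) (j := m + 1) (by omega) le_rfl
    have := h.q_le_q (Nat.zero_le i) hi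
    omega
  · refine (S.cyc.arc_disjoint (h.q_le_q hij hi) ?_).symm
    have := h.u_le_u hi le_rfl
    have := h.q_le_q (Nat.zero_le j) (by omega)
    omega

lemma joinRegion_Q_disjoint_region {i j k : ℕ} (hi : i ≤ m + 1) (hj : j ≤ m + 1) (hk : k ≤ m) :
    Disjoint (S.joinRegion c (q i) (u i) (q j) (u j)) (S.region p (u k) (q (k + 1))) := by
  rw [joinRegion, Set.disjoint_union_left, Set.disjoint_union_left]
  exact ⟨⟨region_disjoint_region (h.arc_QP_disjoint hi hk) (h.whole i hi),
    region_disjoint_region (h.arc_QP_disjoint hj hk) (h.whole j hj)⟩,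
    inner_disjoint_region (h.notMem' k hk)⟩

lemma joinRegion_disjoint {i j k l : ℕ} (hi : i ≤ m + 1) (hj : j ≤ m + 1) (hk : k ≤ m)
    (hl : l ≤ m) : Disjoint (S.joinRegion c (q i) (u i) (q j) (u j))
      (S.joinRegion p (u k) (q (k + 1)) (u l) (q (l + 1))) := by
  rw [joinRegion.eq_def S p, Set.disjoint_union_right, Set.disjoint_union_right]
  refine ⟨⟨h.joinRegion_Q_disjoint_region hi hj hk, h.joinRegion_Q_disjoint_region hi hj hl⟩, ?_⟩
  rw [joinRegion, Set.disjoint_union_left, Set.disjoint_union_left]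
  exact ⟨⟨(inner_disjoint_region (h.notMem i hi)).symm,
    (inner_disjoint_region (h.notMem j hj)).symm⟩,
    S.inner_disjoint _ _ h.ne⟩

end IsAlternating

end BridgeSystem

/-! ### Exchanges on alternating intervals -/

namespace BridgeSystem

variable {V ι : Type*} {G : SimpleGraph V} {S : BridgeSystem G ι} [Fintype ι]

namespace IsAlternating

variable {c p : ι} {q u : ℕ → ℤ} {m : ℕ} {d d' : ℕ → Traces V}
  (h : S.IsAlternating c p q u m) (hQ : ∀ i ≤ m + 1, S.IsTraced c (q i) (u i) (d i))
  (hP : ∀ i ≤ m, S.IsTraced p (u i) (q (i + 1)) (d' i))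
include h

section

include hQ

lemma fwdJoin_path {i j : ℕ} (hi : i ≤ m + 1) (hj : j ≤ m + 1) (hij : i ≠ j) :
    HasPath G (S.joinRegion c (q i) (u i) (q j) (u j)) (S.v (q i)) (S.v (q j))
      (u i - q i + (u j - q j) + S.fwdJoin c (d i) (d j)) :=
  (hQ i hi).fwdJoin_path (hQ j hj) (h.arc_QQ_disjoint hi hj hij) (h.whole i hi)

lemma bwdJoin_path {i j : ℕ} (hi : i ≤ m + 1) (hj : j ≤ m + 1) (hij : i ≠ j) :
    HasPath G (S.joinRegion c (q i) (u i) (q j) (u j)) (S.v (u i - 1)) (S.v (u j - 1))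
      (u i - q i + (u j - q j) + S.bwdJoin c (d i) (d j)) :=
  (hQ i hi).bwdJoin_path (hQ j hj) (h.arc_QQ_disjoint hi hj hij) (h.whole i hi)

end

section

include hP

lemma fwdJoin_path' {i j : ℕ} (hi : i ≤ m) (hj : j ≤ m) (hij : i ≠ j) :
    HasPath G (S.joinRegion p (u i) (q (i + 1)) (u j) (q (j + 1))) (S.v (u i)) (S.v (u j))
      (q (i + 1) - u i + (q (j + 1) - u j) + S.fwdJoin p (d' i) (d' j)) :=
  (hP i hi).fwdJoin_path (hP j hj) (h.arc_PP_disjoint hi hj hij) (h.whole' i hi)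

lemma bwdJoin_path' {i j : ℕ} (hi : i ≤ m) (hj : j ≤ m) (hij : i ≠ j) :
    HasPath G (S.joinRegion p (u i) (q (i + 1)) (u j) (q (j + 1))) (S.v (q (i + 1) - 1))
      (S.v (q (j + 1) - 1)) (q (i + 1) - u i + (q (j + 1) - u j) + S.bwdJoin p (d' i) (d' j)) :=
  (hP i hi).bwdJoin_path (hP j hj) (h.arc_PP_disjoint hi hj hij) (h.whole' i hi)

end

include hQ hP

/-- Exchange on the four intervals `Q i, P i, Q (i + 1), P (i + 1)`. -/
lemma fwdJoin_add_bwdJoin_le {i : ℕ} (hi : i < m) :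
    S.fwdJoin c (d i) (d (i + 1)) + S.bwdJoin p (d' i) (d' (i + 1)) ≤ 0 := by
  have h1 := h.lt i (by omega)
  have h2 := h.lt' i (by omega)
  have h3 := h.lt (i + 1) (by omega)
  have h4 : u (i + 1) < q (i + 2) := h.lt' (i + 1) (by omega)
  have h5 := h.lt (i + 2) (by omega)
  have h6 := h.u_le_u (i := i + 2) (j := m + 1) (by omega) le_rfl
  have h7 := h.q_le_q (i := 0) (j := i) (by omega) (by omega)
  have h8 := h.le
  have h9 : q (i + 1 + 1) = q (i + 2) := rfl
  have := S.cyc.add_le_of_hasPath_of_hasPath h1 h2 h3 h4 (by omega)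
    (h.fwdJoin_path hQ (i := i) (j := i + 1) (by omega) (by omega) (by omega))
    (h.bwdJoin_path' hP (i := i) (j := i + 1) (by omega) (by omega) (by omega))
    (h.joinRegion_disjoint (by omega) (by omega) (by omega) (by omega))
    (joinRegion_disjoint_arc (S.cyc.arc_disjoint (by omega) (by omega))
      (S.cyc.arc_disjoint (by omega) (by omega)))
    (joinRegion_disjoint_arc (S.cyc.arc_disjoint (by omega) (by omega))
      (S.cyc.arc_disjoint (by omega) (by omega)))
  omega

/-- Exchange on the four intervals `P i, Q (i + 1), P (i + 1), Q (i + 2)`. -/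
lemma fwdJoin_add_bwdJoin_le' {i : ℕ} (hi : i < m) :
    S.fwdJoin p (d' i) (d' (i + 1)) + S.bwdJoin c (d (i + 1)) (d (i + 2)) ≤ 0 := by
  have h1 := h.lt' i (by omega)
  have h2 := h.lt (i + 1) (by omega)
  have h3 : u (i + 1) < q (i + 2) := h.lt' (i + 1) (by omega)
  have h4 := h.lt (i + 2) (by omega)
  have h5 := h.lt i (by omega)
  have h6 := h.u_le_u (i := i + 2) (j := m + 1) (by omega) le_rfl
  have h7 := h.q_le_q (i := 0) (j := i) (by omega) (by omega)
  have h8 := h.le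
  have h9 : q (i + 1 + 1) = q (i + 2) := rfl
  have := S.cyc.add_le_of_hasPath_of_hasPath h1 h2 h3 h4 (by omega)
    (h.fwdJoin_path' hP (i := i) (j := i + 1) (by omega) (by omega) (by omega))
    (h.bwdJoin_path hQ (i := i + 1) (j := i + 2) (by omega) (by omega) (by omega))
    (h.joinRegion_disjoint (by omega) (by omega) (by omega) (by omega)).symm
    (joinRegion_disjoint_arc (S.cyc.arc_disjoint (by omega) (by omega))
      (S.cyc.arc_disjoint (by omega) (by omega)))
    (joinRegion_disjoint_arc (S.cyc.arc_disjoint (by omega) (by omega))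
      (S.cyc.arc_disjoint (by omega) (by omega)))
  omega

/-- The path from the first vertex of the union of the intervals that joins the first vertices of
the last two intervals `Q i`. -/
lemma fwd_path_last : HasPath G (S.region p (q 0) (u (m + 1))) (S.v (q 0)) ((d' m).bwd false)
    (u (m + 1) - q 0 + (S.fwdJoin c (d m) (d (m + 1)) + (d' m).bwdEx false)) := by
  have h1 := h.lt m (by omega)
  have h2 := h.lt' m le_rfl
  have h3 := h.lt (m + 1) (by omega)
  have h4 := h.le
  have h5 := h.q_le_q (i := 0) (j := m) (by omega) (by omega)
  have e1 := (h.fwdJoin_path hQ (i := m) (j := m + 1) (by omega) (by omega) (by omega)).append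
    (S.cyc.adj' (by omega)).symm ((hP m le_rfl).bwd_path false)
    (h.joinRegion_Q_disjoint_region (by omega) (by omega) le_rfl)
  have e2 := S.cyc.hasPath_arc_append e1 h5 (by omega) (by
    rw [Set.disjoint_union_right]
    exact ⟨(joinRegion_disjoint_arc (S.cyc.arc_disjoint le_rfl (by omega)).symm
      (S.cyc.arc_disjoint (by omega) (by omega)).symm).symm,
      (region_disjoint_arc (S.cyc.arc_disjoint (by omega) (by omega)).symm).symm⟩)
  refine e2.mono (Set.union_subset ?_ (Set.union_subset ?_ ?_)) (by omega)
  · exact (arc_mono le_rfl (by omega)).trans arc_subset_region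
  · exact h.joinRegion_subset (by omega) (by omega)
  · exact h.region_P_subset le_rfl

/-- The path from the first vertex of the union of the intervals that joins the first vertices of
the last and the first interval `Q i`. -/
lemma fwd_path_wrap : HasPath G (S.region p (q 0) (u (m + 1))) (S.v (q 0)) ((d' 0).bwd true)
    (u (m + 1) - q 0 + (S.fwdJoin c (d (m + 1)) (d 0) + (d' 0).bwdEx true)) := by
  have h1 := h.lt 0 (by omega)
  have h2 := h.lt' 0 (by omega)
  have h3 := h.lt (m + 1) (by omega)
  have h4 := h.le
  have h5 := h.q_le_q (i := 1) (j := m + 1) (by omega) (by omega)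
  have e1 := S.cyc.hasPath_arc_append_rev ((hP 0 (by omega)).bwd_path true) h5 (by omega)
    (region_disjoint_arc (S.cyc.arc_disjoint (by omega) (by omega))).symm
  have e2 := (h.fwdJoin_path hQ (i := m + 1) (j := 0) (by omega) (by omega) (by omega)).symm.append
    (S.cyc.adj' (by omega)).symm e1 (by
      rw [Set.disjoint_union_right]
      exact ⟨joinRegion_disjoint_arc (S.cyc.arc_disjoint (by omega) (by omega)).symm
        (S.cyc.arc_disjoint (by omega) (by omega)),
        h.joinRegion_Q_disjoint_region (by omega) (by omega) (by omega)⟩)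
  refine e2.mono (Set.union_subset ?_ (Set.union_subset ?_ ?_)) (by omega)
  · exact h.joinRegion_subset (by omega) (by omega)
  · exact (arc_mono (by omega) (by omega)).trans arc_subset_region
  · exact h.region_P_subset (by omega)

/-- The path from the last vertex of the union of the intervals that joins the last vertices of
the first two intervals `Q i`. -/
lemma bwd_path_first : HasPath G (S.region p (q 0) (u (m + 1))) (S.v (u (m + 1) - 1))
    ((d' 0).fwd true)
    (u (m + 1) - q 0 + (S.bwdJoin c (d 0) (d 1) + (d' 0).fwdEx true)) := by
  have h1 := h.lt 0 (by omega)
  have h2 := h.lt' 0 (by omega)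
  have h3 := h.lt 1 (by omega)
  have h4 := h.le
  have h5 := h.u_le_u (i := 1) (j := m + 1) (by omega) (by omega)
  rw [zero_add] at h2
  have e1 := (h.bwdJoin_path hQ (i := 0) (j := 1) (by omega) (by omega) (by omega)).symm.append
    (S.cyc.adj' (by omega)) ((hP 0 (by omega)).fwd_path true)
    (h.joinRegion_Q_disjoint_region (by omega) (by omega) (by omega))
  rw [zero_add] at e1
  have e2 := S.cyc.hasPath_arc_append_rev e1 h5 (by omega) (by
    rw [Set.disjoint_union_right]
    exact ⟨(joinRegion_disjoint_arc (S.cyc.arc_disjoint (by omega) (by omega))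
      (S.cyc.arc_disjoint (by omega) (by omega))).symm,
      (region_disjoint_arc (S.cyc.arc_disjoint (by omega) (by omega))).symm⟩)
  refine e2.mono (Set.union_subset ?_ (Set.union_subset ?_ ?_)) (by omega)
  · exact (arc_mono (by omega) (by omega)).trans arc_subset_region
  · exact h.joinRegion_subset (by omega) (by omega)
  · exact h.region_P_subset (Nat.zero_le m)

/-- The path from the last vertex of the union of the intervals that joins the last vertices of
the last and the first interval `Q i`. -/
lemma bwd_path_wrap : HasPath G (S.region p (q 0) (u (m + 1))) (S.v (u (m + 1) - 1))
    ((d' m).fwd false)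
    (u (m + 1) - q 0 + (S.bwdJoin c (d (m + 1)) (d 0) + (d' m).fwdEx false)) := by
  have h1 := h.lt 0 (by omega)
  have h2 := h.lt' m (by omega)
  have h3 := h.lt (m + 1) (by omega)
  have h4 := h.le
  have h5 := h.u_le_u (i := 0) (j := m) (by omega) (by omega)
  have e1 := S.cyc.hasPath_arc_append ((hP m le_rfl).fwd_path false) h5 (by omega)
    (region_disjoint_arc (S.cyc.arc_disjoint (by omega) (by omega)).symm).symm
  have e2 := (h.bwdJoin_path hQ (i := m + 1) (j := 0) (by omega) (by omega) (by omega)).append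
    (S.cyc.adj' (by omega)) e1 (by
      rw [Set.disjoint_union_right]
      exact ⟨joinRegion_disjoint_arc (S.cyc.arc_disjoint (by omega) (by omega)).symm
        (S.cyc.arc_disjoint (by omega) (by omega)),
        h.joinRegion_Q_disjoint_region (by omega) (by omega) (by omega)⟩)
  refine e2.mono (Set.union_subset ?_ (Set.union_subset ?_ ?_)) (by omega)
  · exact h.joinRegion_subset (by omega) (by omega)
  · exact (arc_mono (by omega) (by omega)).trans arc_subset_region
  · exact h.region_P_subset le_rfl

/-- The intervals `P i` are linked to a chain by exchanges, each of which also uses two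
consecutive intervals `Q i`. The joins of the last with the first interval `Q i`, and one further
join on either side, are used by the paths through the union of the intervals. -/
lemma exists_isTraced : ∃ d, S.IsTraced p (q 0) (u (m + 1)) d := by
  refine ⟨⟨fun b => cond b ((d' m).bwd false) ((d' 0).bwd true),
    fun b => cond b ((d' 0).fwd true) ((d' m).fwd false),
    fun b => cond b (S.fwdJoin c (d m) (d (m + 1)) + (d' m).bwdEx false)
      (S.fwdJoin c (d (m + 1)) (d 0) + (d' 0).bwdEx true),
    fun b => cond b (S.bwdJoin c (d 0) (d 1) + (d' 0).fwdEx true)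
      (S.bwdJoin c (d (m + 1)) (d 0) + (d' m).fwdEx false),
    fun φ => ∑ i ∈ Finset.range (m + 1), (d' i).cr φ +
      ∑ i ∈ Finset.range m, sep φ ((d' i).fwd false) ((d' (i + 1)).fwd true) +
      ∑ i ∈ Finset.range m, sep φ ((d' i).bwd false) ((d' (i + 1)).bwd true)⟩, ?_, ?_, ?_, ?_⟩
  · rintro (_ | _)
    · exact h.fwd_path_wrap hQ hP
    · exact h.fwd_path_last hQ hP
  · rintro (_ | _)
    · exact h.bwd_path_wrap hQ hP
    · exact h.bwd_path_first hQ hP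
  · have hc := four_mul_card_le_sum_join (m := m + 1) (by omega) hQ h.cover_Q
    rw [Finset.sum_range_succ (fun i => S.fwdJoin c (d i) (d (i + 1))),
      Finset.sum_range_succ' (fun i => S.bwdJoin c (d i) (d (i + 1)))] at hc
    have hb := Finset.sum_le_sum fun i (hi : i ∈ Finset.range (m + 1)) =>
      (hP i (by rw [Finset.mem_range] at hi; omega)).bound
    have e1 := sum_range_cyclic (fun i => (d' i).fwdEx false) (fun i => (d' i).fwdEx true) m
    have e2 := sum_range_cyclic (fun i => (d' i).bwdEx false) (fun i => (d' i).bwdEx true) m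
    have f1 := Finset.sum_le_sum fun i (hi : i ∈ Finset.range m) =>
      h.fwdJoin_add_bwdJoin_le hQ hP (Finset.mem_range.mp hi)
    have f2 := Finset.sum_le_sum fun i (hi : i ∈ Finset.range m) =>
      h.fwdJoin_add_bwdJoin_le' hQ hP (Finset.mem_range.mp hi)
    have g1 := sum_others_le S c p q u m
    have g2 := sum_alternating q u m
    simp only [bwdJoin.eq_def S p, fwdJoin.eq_def S p] at f1 f2
    simp only [cond_true, cond_false]
    push_cast
    simp only [Finset.sum_add_distrib, Finset.sum_sub_distrib, ← Finset.mul_sum, Finset.sum_const,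
      Finset.card_range, nsmul_eq_mul] at hb hc e1 e2 f1 f2 g1 g2 ⊢
    rw [Finset.sum_comm (s := S.cuts p), Finset.sum_comm (s := S.cuts p) (t := Finset.range m),
      Finset.sum_comm (s := S.cuts p) (t := Finset.range m)]
    push_cast at hb hc e1 e2 f1 f2 g1 g2 ⊢
    linarith
  · intro φ
    have hch := IsFourCut.chain (m := m) fun i hi => ((hP i hi).fourCut φ).swap
    rw [← h.cover_P] at hch
    exact ⟨hch.mem₁, hch.mem₃, hch.mem₄, hch.mem₂,
      fun τ => (hch.four_le τ).imp id fun _ => by dsimp only [cond_true, cond_false]; omega⟩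

end IsAlternating

end BridgeSystem

/-! ### Existence of alternating intervals and of traces -/

/-- A stretch of integers is cut into maximal runs without elements of `O` and runs without
elements of `D`, in turn. -/
lemma exists_runs {D O : ℤ → Prop} (hDO : ∀ i, D i → ¬ O i) {s t : ℤ} (hst : s < t) (hs : D s) :
    ∃ (M : ℕ) (b : ℕ → ℤ), b 0 = s ∧ b (M + 1) = t ∧ (∀ j ≤ M, b j < b (j + 1)) ∧
      (∀ j ≤ M, Even j → D (b j) ∧ ∀ i, b j ≤ i → i < b (j + 1) → ¬ O i) ∧
      (∀ j ≤ M, ¬ Even j → O (b j) ∧ ∀ i, b j ≤ i → i < b (j + 1) → ¬ D i) := by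
  obtain ⟨k, rfl⟩ : ∃ k : ℕ, t = s + 1 + k := ⟨(t - s - 1).toNat, by omega⟩
  clear hst
  induction k with
  | zero =>
    refine ⟨0, fun j => s + j, by simp, by simp, fun j _ => by push_cast; omega, fun j hj _ => ?_,
      fun j hj hj' => ?_⟩
    · obtain rfl : j = 0 := by omega
      refine ⟨by simpa using hs, fun i h1 h2 => ?_⟩
      obtain rfl : i = s := by push_cast at h1 h2; omega
      exact hDO i hs
    · obtain rfl : j = 0 := by omega
      simp at hj'
  | succ k ih =>
    obtain ⟨M, b, h0, hM, hlt, hD, hO⟩ := ih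
    set r := s + 1 + (k : ℤ) with hr
    have hr' : s + 1 + ((k + 1 : ℕ) : ℤ) = r + 1 := by push_cast; omega
    rw [hr']
    by_cases hbad : (Even M ∧ O r) ∨ (¬ Even M ∧ D r)
    · -- a new run starts at `r`
      have hself : ∀ i, r ≤ i → i < r + 1 → i = r := fun i _ _ => by omega
      have hold : ∀ j ≤ M, Function.update b (M + 2) (r + 1) j = b j ∧
          Function.update b (M + 2) (r + 1) (j + 1) = b (j + 1) := fun j hj =>
        ⟨Function.update_of_ne (by omega) .., Function.update_of_ne (by omega) ..⟩
      have hlast : Function.update b (M + 2) (r + 1) (M + 1) = r ∧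
          Function.update b (M + 2) (r + 1) (M + 1 + 1) = r + 1 :=
        ⟨(Function.update_of_ne (by omega) ..).trans hM, Function.update_self ..⟩
      refine ⟨M + 1, Function.update b (M + 2) (r + 1), (hold 0 (by omega)).1.trans h0, hlast.2,
        fun j hj => ?_, fun j hj => ?_, fun j hj => ?_⟩
      · rcases hj.eq_or_lt with rfl | hj
        · rw [hlast.1, hlast.2]
          omega
        · rw [(hold j (by omega)).1, (hold j (by omega)).2]
          exact hlt j (by omega)
      · rcases hj.eq_or_lt with rfl | hj
        · rw [hlast.1, hlast.2, Nat.even_add_one]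
          intro he
          rcases hbad with hb | hb
          · exact absurd hb.1 he
          · exact ⟨hb.2, fun i h1 h2 => hself i h1 h2 ▸ hDO r hb.2⟩
        · rw [(hold j (by omega)).1, (hold j (by omega)).2]
          exact hD j (by omega)
      · rcases hj.eq_or_lt with rfl | hj
        · rw [hlast.1, hlast.2, Nat.even_add_one, not_not]
          intro he
          rcases hbad with hb | hb
          · exact ⟨hb.2, fun i h1 h2 => hself i h1 h2 ▸ fun h => hDO r h hb.2⟩
          · exact absurd he hb.1
        · rw [(hold j (by omega)).1, (hold j (by omega)).2]
          exact hO j (by omega)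
    · -- the last run is extended by `r`
      have hold : ∀ j ≤ M, Function.update b (M + 1) (r + 1) j = b j := fun j hj =>
        Function.update_of_ne (by omega) ..
      have hext : ∀ i, b M ≤ i → i < r + 1 → i = r ∨ (b M ≤ i ∧ i < b (M + 1)) :=
        fun i _ _ => by omega
      refine ⟨M, Function.update b (M + 1) (r + 1), (hold 0 (by omega)).trans h0,
        Function.update_self .., fun j hj => ?_, fun j hj => ?_, fun j hj => ?_⟩
      · rw [hold j hj]
        rcases hj.eq_or_lt with rfl | hj
        · rw [Function.update_self]
          have := hlt j le_rfl
          omega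
        · rw [hold (j + 1) hj]
          exact hlt j (by omega)
      · rw [hold j hj]
        rcases hj.eq_or_lt with rfl | hj
        · rw [Function.update_self]
          intro he
          refine ⟨(hD j le_rfl he).1, fun i h1 h2 => ?_⟩
          rcases hext i h1 h2 with rfl | ⟨h1, h2⟩
          · exact fun h => hbad (.inl ⟨he, h⟩)
          · exact (hD j le_rfl he).2 i h1 h2
        · rw [hold (j + 1) hj]
          exact hD j (by omega)
      · rw [hold j hj]
        rcases hj.eq_or_lt with rfl | hj
        · rw [Function.update_self]
          intro he
          refine ⟨(hO j le_rfl he).1, fun i h1 h2 => ?_⟩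
          rcases hext i h1 h2 with rfl | ⟨h1, h2⟩
          · exact fun h => hbad (.inr ⟨he, h⟩)
          · exact (hO j le_rfl he).2 i h1 h2
        · rw [hold (j + 1) hj]
          exact hO j (by omega)

namespace BridgeSystem

variable {V ι : Type*} {G : SimpleGraph V} {S : BridgeSystem G ι}

lemma IsWhole.pred {p : ι} {s t : ℤ} (hw : S.IsWhole p s t) (h : ∀ x ≠ p, S.v (t - 1) ∉ S.att x) :
    S.IsWhole p s (t - 1) := by
  intro x hx z hz hz' y hy
  obtain ⟨i, ⟨h1, h2⟩, rfl⟩ := hw x hx z hz (arc_mono le_rfl (by omega) hz') hy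
  refine mem_arc h1 ?_
  by_contra hi
  obtain rfl : i = t - 1 := by omega
  exact h x hx hy

/-- A branch at `p` with an attachment in a whole interval has all its attachments there. -/
lemma IsWhole.letters_subset {p c : ι} {s t : ℤ} {D : Set ι} (hw : S.IsWhole p s t)
    (ht : t ≤ s + S.n) (hD : IsBranch S.T D c p) {x : ι} (hx : x ∈ D) {z : V} (hz : z ∈ S.att x)
    (hz' : z ∈ arc S.v s t) : S.letters D ⊆ arc S.v s t := by
  intro a ha
  obtain ⟨y, hy, hay⟩ := mem_letters.mp ha
  suffices h : S.att y ⊆ arc S.v s t from h hay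
  have hr := hD.connected x hx y hy
  clear hay hy
  induction hr with
  | refl => exact hw x (fun e => hD.notMem (e ▸ hx)) z hz hz'
  | @tail a b _ hab ih =>
    obtain ⟨a1, b1, a2, e1, e2, e3, e4, -, hb, -⟩ :=
      S.cyc.exists_between_of_cross ((S.adj_iff a b hab.1.ne).mp hab.1) ih ht
    exact hw b (fun e => hD.notMem (e ▸ hab.2)) _ hb (mem_arc (by omega) (by omega))

lemma not_cross_branch {p c y : ι} {D : Set ι} (hD : IsBranch S.T D c p) (hy : y ∉ D)
    (hyp : y ≠ p) : ¬ Cross S.v S.n (S.letters D) (S.att y) :=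
  not_cross_letters_att hD.connected hy fun x hx hxy => hyp (hD.eq_of_adj x hx y hy hxy).2

variable [Fintype ι]

/-- A whole interval that begins and ends with attachments of a branch at `p` splits into
alternating intervals for the branch and for the rest. -/
lemma exists_isAlternating {p c : ι} {s t : ℤ} {D : Set ι} (hst : s < t) (ht : t ≤ s + S.n)
    (hw : S.IsWhole p s t) (hout : ∃ z ∈ S.att p, z ∉ arc S.v s t) (hD : IsBranch S.T D c p)
    (hs : S.v s ∈ S.letters D) (hlast : S.v (t - 1) ∈ S.letters D) :
    ∃ (m : ℕ) (q u : ℕ → ℤ), q 0 = s ∧ u (m + 1) = t ∧ S.IsAlternating c p q u m ∧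
      (∀ i ≤ m + 1, S.v (q i) ∈ S.letters D) ∧ (∀ i ≤ m, ∃ x, S.v (u i) ∈ S.att x) ∧
      ∀ i ≤ m + 1, ∃ z ∈ S.att c, z ∉ arc S.v (q i) (u i) := by
  obtain ⟨x0, hx0, hsx⟩ := mem_letters.mp hs
  have hsub := hw.letters_subset ht hD hx0 hsx (mem_arc le_rfl hst)
  have hcross := (S.adj_iff c p hD.adj.ne).mp hD.adj
  have hsubc : S.att c ⊆ arc S.v s t := fun z hz => hsub (mem_letters_of_mem hD.mem hz)
  obtain ⟨M, b, h0, hM, hlt, hDr, hOr⟩ := exists_runs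
    (D := fun i => S.v i ∈ S.letters D) (O := fun i => ∃ y, y ∉ D ∧ S.v i ∈ S.att y)
    (fun i hi ⟨y, hy, hiy⟩ => hy (mem_of_mem_letters hi hiy)) hst hs
  -- the last run belongs to the branch
  have hME : Even M := by
    by_contra he
    have := hlt M le_rfl
    exact (hOr M le_rfl he).2 (t - 1) (by omega) (by omega) hlast
  obtain ⟨k, rfl⟩ := hME
  -- an attachment of `p` lies between two attachments of `c`
  have hk : k ≠ 0 := by
    rintro rfl
    obtain ⟨a, b', a', e1, e2, e3, e4, -, hb, -⟩ := S.cyc.exists_between_of_cross hcross hsubc ht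
    exact (hDr 0 le_rfl (by simp)).2 b' (by omega)
      (by simp only [add_zero, zero_add] at hM ⊢; omega)
      ⟨p, hD.notMem, hb⟩
  obtain ⟨m, rfl⟩ : ∃ m, k = m + 1 := ⟨k - 1, by omega⟩
  obtain ⟨q, hq⟩ : ∃ q : ℕ → ℤ, ∀ i, q i = b (2 * i) := ⟨_, fun _ => rfl⟩
  obtain ⟨u, hu⟩ : ∃ u : ℕ → ℤ, ∀ i, u i = b (2 * i + 1) := ⟨_, fun _ => rfl⟩
  have hqs : q 0 = s := by rw [hq, ← h0]
  have hut : u (m + 1) = t := by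
    rw [hu, ← hM]
    congr 1
    omega
  have hqu : ∀ i ≤ m + 1, q i < u i := fun i hi => by
    rw [hq, hu]
    exact hlt _ (by omega)
  have huq : ∀ i ≤ m, u i < q (i + 1) := fun i hi => by
    rw [hq, hu]
    exact hlt _ (by omega)
  have hqD : ∀ i ≤ m + 1, S.v (q i) ∈ S.letters D := fun i hi => by
    rw [hq]
    exact (hDr _ (by omega) (by simp)).1
  have hQ : ∀ i ≤ m + 1, ∀ j, q i ≤ j → j < u i → ∀ y, S.v j ∈ S.att y → y ∈ D := by
    intro i hi j h1 h2 y hy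
    rw [hq] at h1
    rw [hu] at h2
    by_contra hyD
    exact (hDr (2 * i) (by omega) (by simp)).2 j h1 h2 ⟨y, hyD, hy⟩
  have huO : ∀ i ≤ m, ∃ y, y ∉ D ∧ S.v (u i) ∈ S.att y := fun i hi => by
    rw [hu]
    exact (hOr _ (by omega) (by simp)).1
  have hP : ∀ i ≤ m, ∀ j, u i ≤ j → j < q (i + 1) → ∀ y, S.v j ∈ S.att y → y ∉ D := by
    intro i hi j h1 h2 y hy hyD
    rw [hu] at h1
    rw [hq] at h2
    exact (hOr (2 * i + 1) (by omega) (by simp)).2 j h1 h2 (mem_letters_of_mem hyD hy)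
  have hqq : ∀ i j, i ≤ j → j ≤ m + 1 → q i ≤ q j := by
    intro i j hij hj
    induction j, hij using Nat.le_induction with
    | base => exact le_rfl
    | succ j _ ih =>
      have := ih (by omega)
      have := hqu j (by omega)
      have := huq j (by omega)
      omega
  have huu : ∀ i ≤ m + 1, u i ≤ t := by
    intro i hi
    rcases hi.eq_or_lt with rfl | hi
    · exact hut.le
    · have := huq i (by omega)
      have := hqq (i + 1) (m + 1) (by omega) le_rfl
      have := hqu (m + 1) le_rfl
      omega
  have hqt : ∀ i ≤ m + 1, q i < t := fun i hi => (hqu i hi).trans_le (huu i hi)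
  have hsq : ∀ i ≤ m + 1, s ≤ q i := fun i hi => hqs ▸ hqq 0 i (by omega) hi
  -- each interval of the rest contains an attachment of `p`
  have hpP : ∀ i ≤ m, ∃ j, u i ≤ j ∧ j < q (i + 1) ∧ S.v j ∈ S.att p := by
    intro i hi
    obtain ⟨y, hy, hyu⟩ := huO i hi
    obtain ⟨j, h1, h2, h3⟩ := exists_mem_att_between hD (hqu i (by omega)) (huq i hi)
      (by have := hsq i (by omega); have := hqt (i + 1) (by omega); omega) (hqD i (by omega))
      (hqD (i + 1) (by omega)) hy hyu
    refine ⟨j, ?_, h2, h3⟩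
    by_contra hj
    exact hD.notMem (hQ i (by omega) j h1.le (by omega) p h3)
  obtain ⟨o, ho1, ho2, ho3⟩ : ∃ o, t ≤ o ∧ o < s + S.n ∧ S.v o ∈ S.att p := by
    obtain ⟨z, hz, hz'⟩ := hout
    obtain ⟨o, rfl, h1, h2⟩ := S.cyc.exists_pos (S.att_subset p hz) s
    refine ⟨o, ?_, h2, hz⟩
    by_contra ho
    exact hz' (mem_arc h1 (by omega))
  -- a bridge of the branch other than `c` does not meet two of its intervals, for it would
  -- cross `p`
  have hQQ : ∀ i j, i < j → j ≤ m + 1 → ∀ y ∈ D, y ≠ c → ∀ k l, q i ≤ k → k < u i → q j ≤ l →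
      l < u j → S.v k ∈ S.att y → S.v l ∈ S.att y → False := by
    intro i j hij hj y hy hyc k l h1 h2 h3 h4 hk hl
    obtain ⟨r, r1, r2, r3⟩ := hpP i (by omega)
    have := hqq (i + 1) j (by omega) hj
    have := huu j hj
    have := hsq i (by omega)
    have hc : Cross S.v S.n (S.att y) (S.att p) :=
      ⟨k, r, l, o, by omega, by omega, by omega, by omega, hk, r3, hl, ho3⟩
    have hadj := (S.adj_iff y p (fun e => hD.notMem (e ▸ hy))).mpr hc
    exact hyc (hD.eq_of_adj y hy p hD.notMem hadj).1
  refine ⟨m, q, u, hqs, hut, ⟨hqu, huq, by rw [hut, hqs]; exact ht, ?_, ?_, ?_, ?_, hD.adj.ne,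
    by rw [hqs, hut]; exact hsubc, ?_⟩, hqD, fun i hi => (huO i hi).imp fun _ h => h.2, ?_⟩
  · rintro i hi y hyc _ hz ⟨k, ⟨h1, h2⟩, rfl⟩ z' hz'
    have hy := hQ i hi k h1 h2 y hz
    have hz'D := mem_letters_of_mem hy hz'
    rcases exists_of_mem_arc (v := S.v) (q := q) (u := u) (m := m)
      (by rw [hqs, hut]; exact hsub hz'D) with ⟨j, hj, l, ⟨h3, h4⟩, rfl⟩ | ⟨j, hj, l, ⟨h3, h4⟩, rfl⟩
    · rcases lt_trichotomy i j with hij | rfl | hij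
      · exact (hQQ i j hij hj y hy hyc k l h1 h2 h3 h4 hz hz').elim
      · exact mem_arc h3 h4
      · exact (hQQ j i hij hi y hy hyc l k h3 h4 h1 h2 hz' hz).elim
    · exact absurd hy (hP j hj l h3 h4 y hz')
  · rintro i hi y hyp _ hz ⟨k, ⟨h1, h2⟩, rfl⟩ z' hz'
    have hy := hP i hi k h1 h2 y hz
    have e1 := hsq i (by omega)
    have e2 := hqt (i + 1) (by omega)
    have e3 := hqu i (by omega)
    obtain ⟨l, ⟨h3, h4⟩, rfl⟩ := hw y hyp _ hz (mem_arc (by omega) (by omega)) hz'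
    have hnc := not_cross_branch hD hy hyp
    have hne : ∀ j ≤ m + 1, l ≠ q j := fun j hj e =>
      hy (mem_of_mem_letters (hqD j hj) (e ▸ hz'))
    have hne1 := hne i (by omega)
    have hne2 := hne (i + 1) (by omega)
    by_contra hl
    have hl' : l < q i ∨ q (i + 1) < l := by
      by_contra hcon
      by_cases hlu : u i ≤ l
      · exact hl (mem_arc hlu (by omega))
      · exact hy (hQ i (by omega) l (by omega) (by omega) y hz')
    rcases hl' with hl' | hl'
    · exact hnc (S.cyc.cross_symm ⟨l, q i, k, q (i + 1), hl', by omega, h2, by omega, hz',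
        hqD i (by omega), hz, hqD (i + 1) (by omega)⟩)
    · exact hnc ⟨q i, k, q (i + 1), l, by omega, h2, hl', by omega, hqD i (by omega), hz,
        hqD (i + 1) (by omega), hz'⟩
  · rintro i hi hp
    obtain ⟨-, _, hz, k, ⟨h1, h2⟩, rfl⟩ := mem_others.mp hp
    exact hD.notMem (hQ i hi k h1 h2 p hz)
  · rintro i hi hp
    obtain ⟨-, _, hz, k, ⟨h1, h2⟩, rfl⟩ := mem_others.mp hp
    exact hP i hi k h1 h2 c hz hD.mem
  · obtain ⟨a, -, -, -, -, -, -, -, ha, -⟩ := hcross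
    rw [hqs, hut]
    exact mem_others.mpr ⟨hD.adj.ne, _, ha, hsubc ha⟩
  · intro i hi
    by_contra hcon
    push Not at hcon
    have e1 := hsq i hi
    have e2 := huu i hi
    obtain ⟨a, b', a', f1, f2, f3, f4, -, hb, -⟩ :=
      S.cyc.exists_between_of_cross hcross hcon (by omega)
    exact hD.notMem (hQ i hi b' (by omega) (by omega) p hb)

/-- Every whole interval that starts with an attachment and does not contain all attachments of
`p` can be traced. -/
theorem exists_isTraced {p : ι} {s t : ℤ} (hst : s < t) (ht : t ≤ s + S.n) (hw : S.IsWhole p s t)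
    (hout : ∃ z ∈ S.att p, z ∉ arc S.v s t) (hs : ∃ x, S.v s ∈ S.att x) :
    ∃ d, S.IsTraced p s t d := by
  induction hN : (t - s).toNat using Nat.strong_induction_on generalizing p s t with
  | _ N ih =>
  have hout' : ∀ s' t', s ≤ s' → t' ≤ t → ∃ z ∈ S.att p, z ∉ arc S.v s' t' := fun s' t' h1 h2 =>
    hout.imp fun z hz => ⟨hz.1, fun h => hz.2 (arc_mono h1 h2 h)⟩
  by_cases hx : ∃ x ≠ p, S.v (t - 1) ∈ S.att x
  · obtain ⟨x, hxp, hx⟩ := hx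
    obtain ⟨D, c, hD, hxD⟩ := IsBranch.exists_of_isTree S.tree hxp
    have hlast := mem_letters_of_mem hxD hx
    by_cases hsD : S.v s ∈ S.letters D
    · obtain ⟨m, q, u, rfl, rfl, hA, hq, hu, hc⟩ :=
        exists_isAlternating hst ht hw hout hD hsD hlast
      have hQ : ∀ i, ∃ d, i ≤ m + 1 → S.IsTraced c (q i) (u i) d := by
        intro i
        by_cases hi : i ≤ m + 1
        · have h1 := hA.lt i hi
          have h2 := hA.q_le_q (Nat.zero_le i) hi
          have h3 := hA.u_le_u hi le_rfl
          have h4 := hA.lt 0 (by omega)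
          have h5 := hA.lt (m + 1) le_rfl
          have h6 : 0 < i → u 0 < q i := fun h => hA.u_lt_q h hi
          have h7 : i < m + 1 → u i < q (m + 1) := fun h => hA.u_lt_q h le_rfl
          obtain ⟨d, hd⟩ := ih _ (by omega) h1 (by omega) (hA.whole i hi) (hc i hi)
            ((mem_letters.mp (hq i hi)).imp fun _ h => h.2) rfl
          exact ⟨d, fun _ => hd⟩
        · exact ⟨⟨fun _ => S.v 0, fun _ => S.v 0, 0, 0, 0⟩, fun h => absurd h hi⟩
      have hP : ∀ i, ∃ d, i ≤ m → S.IsTraced p (u i) (q (i + 1)) d := by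
        intro i
        by_cases hi : i ≤ m
        · have h1 := hA.lt' i hi
          have h2 := hA.q_le_q (Nat.zero_le i) (by omega)
          have h3 := hA.u_le_u (i := i + 1) (j := m + 1) (by omega) le_rfl
          have h4 := hA.lt i (by omega)
          have h5 := hA.lt (i + 1) (by omega)
          obtain ⟨d, hd⟩ := ih _ (by omega) h1 (by omega) (hA.whole' i hi)
            (hout' _ _ (by omega) (by omega)) (hu i hi) rfl
          exact ⟨d, fun _ => hd⟩
        · exact ⟨⟨fun _ => S.v 0, fun _ => S.v 0, 0, 0, 0⟩, fun h => absurd h hi⟩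
      choose d hd using hQ
      choose d' hd' using hP
      exact hA.exists_isTraced hd hd'
    · -- split the interval at the first attachment of the branch
      have hst' : s < t - 1 := by
        by_contra hcon
        obtain rfl : s = t - 1 := by omega
        exact hsD hlast
      obtain ⟨r, ⟨hr1, hr2⟩, hr3⟩ := Int.exists_least_of_bdd
        (P := fun i => s < i ∧ S.v i ∈ S.letters D) ⟨s, fun i hi => hi.1.le⟩ ⟨t - 1, hst', hlast⟩
      have hrt : r ≤ t - 1 := hr3 (t - 1) ⟨hst', hlast⟩
      have hno : ∀ i, s ≤ i → i < r → S.v i ∉ S.letters D := by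
        intro i h1 h2 h3
        rcases h1.eq_or_lt with rfl | h1
        · exact hsD h3
        · have := hr3 i ⟨h1, h3⟩
          omega
      have key : ∀ y ≠ p, ∀ i k, s ≤ i → i < r → r ≤ k → k < t → S.v i ∈ S.att y →
          S.v k ∈ S.att y → False := by
        intro y hyp i k h1 h2 h3 h4 hi hk
        have hy : y ∉ D := fun hy => hno i h1 h2 (mem_letters_of_mem hy hi)
        have hkr : k ≠ r := fun e => hy (mem_of_mem_letters hr2 (e ▸ hk))
        have hkt : k ≠ t - 1 := fun e => hy (mem_of_mem_letters hlast (e ▸ hk))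
        exact not_cross_branch hD hy hyp ⟨r, k, t - 1, i + S.n, by omega, by omega, by omega,
          by omega, hr2, hk, hlast, by rwa [S.cyc.periodic]⟩
      have hw1 : S.IsWhole p s r := by
        rintro y hyp _ hz ⟨i, ⟨h1, h2⟩, rfl⟩ z' hz'
        obtain ⟨k, ⟨h3, h4⟩, rfl⟩ := hw y hyp _ hz (mem_arc h1 (by omega)) hz'
        refine mem_arc h3 ?_
        by_contra hcon
        exact key y hyp i k h1 h2 (by omega) h4 hz hz'
      have hw2 : S.IsWhole p r t := by
        rintro y hyp _ hz ⟨k, ⟨h1, h2⟩, rfl⟩ z' hz'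
        obtain ⟨i, ⟨h3, h4⟩, rfl⟩ := hw y hyp _ hz (mem_arc (by omega) h2) hz'
        refine mem_arc ?_ h4
        by_contra hcon
        exact key y hyp i k h3 (by omega) h1 h2 hz' hz
      obtain ⟨d, hd⟩ := ih _ (by omega) hr1 (by omega) hw1 (hout' _ _ le_rfl (by omega)) hs rfl
      obtain ⟨d', hd'⟩ := ih _ (by omega) (by omega : r < t) (by omega) hw2
        (hout' _ _ (by omega) le_rfl) ((mem_letters.mp hr2).imp fun _ h => h.2) rfl
      exact hd.exists_append hd' hr1 (by omega) ht hw1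
  · push Not at hx
    have hw' := hw.pred hx
    by_cases hp : S.v (t - 1) ∈ S.att p
    · obtain ⟨d', hd'⟩ := IsTraced.exists_single hp
      rw [sub_add_cancel] at hd'
      rcases (show s ≤ t - 1 by omega).eq_or_lt with rfl | hst'
      · exact ⟨d', hd'⟩
      · obtain ⟨d, hd⟩ := ih _ (by omega) hst' (by omega) hw' (hout' _ _ le_rfl (by omega)) hs rfl
        exact hd.exists_append hd' hst' (by omega) ht hw'
    · have hnone : ∀ x, S.v (t - 1) ∉ S.att x := fun x h => by
        by_cases hxp : x = p
        · exact hp (hxp ▸ h)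
        · exact hx x hxp h
      have hst' : s < t - 1 := by
        by_contra hcon
        obtain rfl : s = t - 1 := by omega
        exact hnone _ hs.choose_spec
      obtain ⟨d, hd⟩ := ih _ (by omega) hst' (by omega) hw' (hout' _ _ le_rfl (by omega)) hs rfl
      have := hd.exists_succ hst' (by omega) hnone
      rwa [sub_add_cancel] at this

/-- The inequality for a system of disjoint bridges: cut the cycle open after an attachment of a
bridge `p`, trace the interval consisting of the rest, and close the four paths through
that attachment. -/
theorem two_mul_sum_card_le (S : BridgeSystem G ι) :
    2 * ∑ x, ((S.cuts x).card : ℤ) ≤ S.n := by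
  classical
  have hn := S.cyc.three_le
  by_cases hall : ∀ x, S.cuts x = ∅
  · simp only [hall, Finset.card_empty, Nat.cast_zero, Finset.sum_const_zero, mul_zero]
    omega
  push Not at hall
  obtain ⟨p, hp⟩ := hall
  obtain ⟨e, he⟩ := hp
  obtain ⟨a, ha, b, hb, hab⟩ := S.side_ne p e he
  obtain ⟨s, rfl, -, -⟩ := S.cyc.exists_pos (S.att_subset p ha) 0
  obtain ⟨k, rfl, hk1, hk2⟩ := S.cyc.exists_pos (S.att_subset p hb) s
  have hsk : s < k := lt_of_le_of_ne hk1 fun e' => hab (by rw [e'])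
  obtain ⟨r, ⟨hr1, x0, hr2⟩, hr3⟩ := Int.exists_least_of_bdd
    (P := fun i => s < i ∧ ∃ x, S.v i ∈ S.att x) ⟨s, fun i hi => hi.1.le⟩ ⟨k, hsk, p, hb⟩
  have hrk := hr3 k ⟨hsk, p, hb⟩
  have hmem : ∀ x, ∀ z ∈ S.att x, z ≠ S.v s → z ∈ arc S.v r (s + S.n) := by
    intro x z hz hzs
    obtain ⟨i, rfl, h1, h2⟩ := S.cyc.exists_pos (S.att_subset x hz) s
    have h3 : s < i := lt_of_le_of_ne h1 fun e' => hzs (by rw [e'])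
    exact mem_arc (hr3 i ⟨h3, x, hz⟩) h2
  have hmem' : ∀ x ≠ p, ∀ z ∈ S.att x, z ∈ arc S.v r (s + S.n) := fun x hx z hz =>
    hmem x z hz fun e' => hx (eq_of_mem_att hz (e' ▸ ha))
  have hsr : Disjoint (arc S.v s r) (arc S.v r (s + S.n)) := S.cyc.arc_disjoint le_rfl le_rfl
  have hvs : S.v s ∉ arc S.v r (s + S.n) := Set.disjoint_left.mp hsr (mem_arc le_rfl hr1)
  obtain ⟨d, hd⟩ := exists_isTraced (p := p) (s := r) (t := s + S.n) (by omega) (by omega)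
    (fun x hx _ _ _ z hz => hmem' x hx z hz) ⟨_, ha, hvs⟩ ⟨x0, hr2⟩
  have hfwd : ∀ b, d.fwdEx b +
      ∑ e ∈ S.cuts p, (sep (S.side p e) (d.fwd b) (S.v s) : ℤ) ≤ 1 := by
    intro b
    have h := hasPath_jump (hd.fwd_path b) (S.cyc.hasPath_arc hr1 (by omega)).symm (hd.fwd_mem b) ha
      (region_disjoint_arc hsr.symm) (inner_disjoint_region notMem_others_self) inner_disjoint_arc
    have := S.cyc.le_of_adj h (S.cyc.adj' (by omega))
    linarith
  have hbwd : ∀ b, d.bwdEx b +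
      ∑ e ∈ S.cuts p, (sep (S.side p e) (d.bwd b) (S.v s) : ℤ) ≤ r - s := by
    intro b
    have h1 : HasPath G (arc S.v s (s + 1)) (S.v s) (S.v s) 1 := .refl (mem_arc le_rfl (by omega))
    have h := hasPath_jump (hd.bwd_path b) h1 (hd.bwd_mem b) ha
      (region_disjoint_arc (S.cyc.arc_disjoint (by omega) (by omega)).symm)
      (inner_disjoint_region notMem_others_self) inner_disjoint_arc
    have := S.cyc.le_of_adj h (by rw [← S.cyc.periodic s]; exact (S.cyc.adj' (by omega)).symm)
    linarith
  have hcut : ∀ e ∈ S.cuts p, (4 : ℤ) ≤ d.cr (S.side p e) +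
      sep (S.side p e) (d.bwd true) (S.v s) + sep (S.side p e) (d.bwd false) (S.v s) +
      sep (S.side p e) (d.fwd true) (S.v s) + sep (S.side p e) (d.fwd false) (S.v s) := by
    intro e he
    rcases (hd.fourCut (S.side p e)).four_le (S.side p e (S.v s)) with h | h
    · exfalso
      have hc : ∀ z ∈ S.att p, S.side p e z = S.side p e (S.v s) := by
        intro z hz
        by_cases hzs : z = S.v s
        · rw [hzs]
        · exact h z ⟨hz, hmem p z hz hzs⟩
      obtain ⟨a', ha', b', hb', hab'⟩ := S.side_ne p e he
      exact hab' ((hc a' ha').trans (hc b' hb').symm)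
    · exact_mod_cast h
  have hsum := Finset.sum_le_sum hcut
  simp only [Finset.sum_const, Finset.sum_add_distrib, nsmul_eq_mul] at hsum
  have hle : ∑ x, ((S.cuts x).card : ℤ) ≤
      (S.cuts p).card + ∑ x ∈ S.others p r (s + S.n), ((S.cuts x).card : ℤ) := by
    rw [← Finset.sum_insert (f := fun x => ((S.cuts x).card : ℤ)) notMem_others_self]
    refine (Finset.sum_subset (Finset.subset_univ _) fun x _ hx => ?_).ge
    rw [Finset.mem_insert, not_or] at hx
    rw [Nat.cast_eq_zero, Finset.card_eq_zero, Finset.eq_empty_iff_forall_notMem]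
    intro e' he'
    obtain ⟨a', ha', -⟩ := S.side_ne x e' he'
    exact hx.2 (mem_others.mpr ⟨hx.1, a', ha', hmem' x hx.1 a' ha'⟩)
  have := hd.bound
  have := hfwd true
  have := hfwd false
  have := hbwd true
  have := hbwd false
  linarith

end BridgeSystem

open SimpleGraph

/-! ### The cyclic sequence of a longest cycle -/

/-- The edges of the subgraph `H` join consecutive members of the sequence `v`, whose members are
the vertices of `H`. -/
structure RunsAlong {V : Type*} {G : SimpleGraph V} (v : ℤ → V) (H : G.Subgraph) : Prop where
  verts : H.verts = Set.range v
  adj_iff : ∀ a b, H.Adj a b ↔ ∃ i, s(v i, v (i + 1)) = s(a, b)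

section cycleSeq

variable {V : Type*} {G : SimpleGraph V} {u : V}

/-- The vertices of a closed walk, repeated periodically in both directions. -/
def cycleSeq (L : G.Walk u u) (i : ℤ) : V := L.getVert (i % L.length).toNat

lemma cycleSeq_natCast (L : G.Walk u u) {k : ℕ} (hk : k ≤ L.length) :
    cycleSeq L k = L.getVert k := by
  rcases hk.eq_or_lt with rfl | hk
  · simp [cycleSeq]
  · rw [cycleSeq, Int.emod_eq_of_lt (by omega) (by omega), Int.toNat_natCast]

lemma cycleSeq_add_length (L : G.Walk u u) (i : ℤ) : cycleSeq L (i + L.length) = cycleSeq L i := by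
  simp [cycleSeq]

lemma exists_cycleSeq_eq (L : G.Walk u u) (hL : 0 < L.length) (i : ℤ) :
    ∃ k < L.length, cycleSeq L i = L.getVert k ∧ cycleSeq L (i + 1) = L.getVert (k + 1) := by
  obtain ⟨d, h1, h2, h3⟩ := exists_shift (v := cycleSeq L) (by exact_mod_cast hL)
    (cycleSeq_add_length L) i 0
  obtain ⟨k, hk⟩ := Int.eq_ofNat_of_zero_le h2
  refine ⟨k, by omega, ?_, ?_⟩
  · rw [← h1, hk, cycleSeq_natCast _ (by omega)]
  · rw [← h1, show i + 1 + d = ((k + 1 : ℕ) : ℤ) by push_cast; omega,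
      cycleSeq_natCast _ (by omega)]

lemma isLongestCyclicSeq_cycleSeq {L : G.Walk u u} (hL : IsLongestCycle L) :
    IsLongestCyclicSeq G (cycleSeq L) L.length := by
  have h3 := hL.1.three_le_length
  refine ⟨by exact_mod_cast h3, cycleSeq_add_length L, fun i j hij h1 h2 => ?_, fun i => ?_,
    fun x C hC => by exact_mod_cast hL.2 x C hC⟩
  · have hi := Int.emod_nonneg i (b := L.length) (by omega)
    have hj := Int.emod_nonneg j (b := L.length) (by omega)
    have hi' := Int.emod_lt_of_pos i (b := L.length) (by omega)
    have hj' := Int.emod_lt_of_pos j (b := L.length) (by omega)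
    have h := hL.1.getVert_injOn' (by simp only [Set.mem_ofPred_eq]; omega)
      (by simp only [Set.mem_ofPred_eq]; omega) hij
    have hd : (L.length : ℤ) ∣ i - j := Int.ModEq.dvd (show j % L.length = i % L.length by omega)
    obtain ⟨c, hc⟩ := hd
    have hc0 : c = 0 := by
      have h4 : c < 1 := by nlinarith
      have h5 : -1 < c := by nlinarith
      omega
    rw [hc0] at hc
    omega
  · obtain ⟨k, hk, h1, h2⟩ := exists_cycleSeq_eq L (by omega) i
    rw [h1, h2]
    exact L.adj_getVert_succ hk

lemma runsAlong_cycleSeq {L : G.Walk u u} (hL : 0 < L.length) :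
    RunsAlong (cycleSeq L) L.toSubgraph := by
  constructor
  · ext x
    rw [Walk.mem_verts_toSubgraph, Walk.mem_support_iff_exists_getVert]
    constructor
    · rintro ⟨k, rfl, hk⟩
      exact ⟨k, cycleSeq_natCast L hk⟩
    · rintro ⟨i, rfl⟩
      obtain ⟨k, hk, h1, -⟩ := exists_cycleSeq_eq L hL i
      exact ⟨k, h1.symm, hk.le⟩
  · intro a b
    rw [Walk.toSubgraph_adj_iff]
    constructor
    · rintro ⟨k, h, hk⟩
      refine ⟨k, ?_⟩
      rw [cycleSeq_natCast L hk.le, ← Nat.cast_succ, cycleSeq_natCast L hk]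
      exact h
    · rintro ⟨i, h⟩
      obtain ⟨k, hk, h1, h2⟩ := exists_cycleSeq_eq L hL i
      exact ⟨k, by rw [← h1, ← h2, h], hk⟩

lemma ncard_edgeSet_toSubgraph {L : G.Walk u u} (hL : L.IsCycle) :
    L.toSubgraph.edgeSet.ncard = L.length := by
  classical
  rw [Walk.edgeSet_toSubgraph, ← Walk.length_edges,
    ← List.toFinset_card_of_nodup hL.isTrail.edges_nodup, ← Set.ncard_coe_finset]
  congr 1
  ext e
  simp

end cycleSeq

/-! ### Overlapping and crossing -/

namespace IsLongestCyclicSeq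

variable {V : Type*} {G : SimpleGraph V} {v : ℤ → V} {n : ℤ} (hv : IsLongestCyclicSeq G v n)
include hv

/-- The part of the cycle from position `s` to position `t`, as a walk. -/
lemma exists_walk {s t : ℤ} (hst : s ≤ t) (htn : t < s + n) :
    ∃ w : G.Walk (v s) (v t), w.IsPath ∧ (∀ z, z ∈ w.support ↔ z ∈ arc v s (t + 1)) ∧
      ∀ a b, w.toSubgraph.Adj a b ↔ ∃ i, s ≤ i ∧ i < t ∧ s(v i, v (i + 1)) = s(a, b) := by
  obtain ⟨k, rfl⟩ : ∃ k : ℕ, t = s + k := ⟨(t - s).toNat, by omega⟩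
  clear hst
  induction k with
  | zero =>
    rw [Nat.cast_zero, add_zero]
    refine ⟨.nil, .nil, fun z => ?_, fun a b => ?_⟩
    · rw [Walk.support_nil, List.mem_singleton]
      constructor
      · rintro rfl
        exact mem_arc le_rfl (by omega)
      · rintro ⟨i, ⟨h1, h2⟩, rfl⟩
        congr 1
        omega
    · constructor
      · intro h
        simp [Walk.toSubgraph] at h
      · rintro ⟨i, h1, h2, -⟩
        omega
  | succ k ih =>
    push_cast at htn ⊢
    obtain ⟨w, h1, h2, h3⟩ := ih (by omega)
    have hadj : G.Adj (v (s + k)) (v (s + (k + 1))) := hv.adj' (by ring)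
    have hr : ∀ i, i < s + (k + 1) + 1 ↔ i < s + k + 1 ∨ i = s + (k + 1) := fun i => by omega
    refine ⟨w.concat hadj, ?_, fun z => ?_, fun a b => ?_⟩
    · rw [Walk.concat_isPath_iff, h2, hv.mem_arc_iff (by omega) (by omega) (by omega)]
      exact ⟨h1, by omega⟩
    · rw [Walk.support_concat, List.mem_append, h2, List.mem_singleton]
      constructor
      · rintro (⟨i, ⟨h4, h5⟩, rfl⟩ | rfl)
        · exact mem_arc h4 (by omega)
        · exact mem_arc (by omega) (by omega)
      · rintro ⟨i, ⟨h4, h5⟩, rfl⟩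
        rcases (hr i).mp h5 with h5 | rfl
        · exact .inl (mem_arc h4 h5)
        · exact .inr rfl
    · rw [Walk.adj_toSubgraph_iff_mem_edges, Walk.edges_concat, List.concat_eq_append,
        List.mem_append, ← Walk.adj_toSubgraph_iff_mem_edges, h3, List.mem_singleton]
      constructor
      · rintro (⟨i, h4, h5, h6⟩ | h)
        · exact ⟨i, h4, by omega, h6⟩
        · exact ⟨s + k, by omega, by omega, by rw [h, add_assoc]⟩
      · rintro ⟨i, h4, h5, h6⟩
        rcases (show i < s + k ∨ i = s + k by omega) with h5 | rfl
        · exact .inl ⟨i, h4, h5, h6⟩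
        · exact .inr (by rw [← h6, add_assoc])

lemma edge_inj {i j : ℤ} (h : s(v i, v (i + 1)) = s(v j, v (j + 1))) (h1 : i < j + n)
    (h2 : j < i + n) : i = j := by
  have h3 := hv.three_le
  rw [Sym2.eq_iff] at h
  rcases h with ⟨h, -⟩ | ⟨h, h'⟩
  · exact hv.inj i j h h1 h2
  · rcases (show i + 1 < j + n ∨ i = j + n - 1 by omega) with h4 | rfl
    · obtain rfl := hv.inj (i + 1) j h' (by omega) (by omega)
      have := hv.inj _ _ h (by omega) (by omega)
      omega
    · have := hv.inj _ _ h (by omega) (by omega)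
      omega

/-- Two sets lying on the two closed arcs into which two vertices cut the cycle avoid each other. -/
lemma avoid_of_subset_arc {L B B' : G.Subgraph} (hL : RunsAlong v L) {s t : ℤ} (hst : s < t)
    (htn : t < s + n) (h : attachments L B ⊆ arc v s (t + 1))
    (h' : attachments L B' ⊆ arc v t (s + n + 1)) : Avoid L B B' := by
  obtain ⟨p, hp1, hp2, hp3⟩ := hv.exists_walk hst.le htn
  obtain ⟨q, hq1, hq2, hq3⟩ := hv.exists_walk (s := t) (t := s + n) htn.le (by omega)
  have hshift : ∀ a b, (∃ i, s(v i, v (i + 1)) = s(a, b)) ↔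
      ∃ i, s ≤ i ∧ i < s + n ∧ s(v i, v (i + 1)) = s(a, b) := by
    intro a b
    constructor
    · rintro ⟨i, hi⟩
      obtain ⟨d, hd, h1, h2⟩ := exists_shift (by have := hv.three_le; omega) hv.periodic i s
      refine ⟨i + d, h1, h2, ?_⟩
      rw [hd, add_right_comm, hd, hi]
    · rintro ⟨i, -, -, hi⟩
      exact ⟨i, hi⟩
  refine ⟨v s, v t, p, q.copy rfl (hv.periodic s), hp1, by simpa using hq1, ?_, ?_, ?_, ?_⟩
  · rw [Set.disjoint_left]
    intro e
    induction e with | _ a b => ?_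
    rw [Subgraph.mem_edgeSet, Subgraph.mem_edgeSet, hp3, Walk.adj_toSubgraph_iff_mem_edges,
      Walk.edges_copy, ← Walk.adj_toSubgraph_iff_mem_edges, hq3]
    rintro ⟨i, h1, h2, h3⟩ ⟨j, h4, h5, h6⟩
    have := hv.edge_inj (h3.trans h6.symm) (by omega) (by omega)
    omega
  · ext a b
    · rw [Subgraph.verts_sup, Set.mem_union, Walk.mem_verts_toSubgraph, Walk.mem_verts_toSubgraph,
        Walk.support_copy, hp2, hq2, hL.verts]
      constructor
      · rintro (⟨i, -, rfl⟩ | ⟨i, -, rfl⟩) <;> exact ⟨i, rfl⟩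
      · intro h
        obtain ⟨i, rfl, h1, h2⟩ := hv.exists_pos h s
        by_cases h3 : i < t
        · exact .inl (mem_arc h1 (by omega))
        · exact .inr (mem_arc (by omega) (by omega))
    · rw [Subgraph.sup_adj, hp3, Walk.adj_toSubgraph_iff_mem_edges (p := q.copy _ _),
        Walk.edges_copy, ← Walk.adj_toSubgraph_iff_mem_edges, hq3, hL.adj_iff, hshift]
      constructor
      · rintro (⟨i, h1, h2, h3⟩ | ⟨i, h1, h2, h3⟩) <;> exact ⟨i, by omega, by omega, h3⟩
      · rintro ⟨i, h1, h2, h3⟩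
        by_cases h4 : i < t
        · exact .inl ⟨i, h1, h4, h3⟩
        · exact .inr ⟨i, by omega, h2, h3⟩
  · intro z hz
    rw [Walk.mem_verts_toSubgraph, hp2]
    exact h hz
  · intro z hz
    rw [Walk.mem_verts_toSubgraph, Walk.support_copy, hq2]
    exact h' hz

lemma avoid_of_not_cross {L B B' : G.Subgraph} (hL : RunsAlong v L)
    (hd : Disjoint (attachments L B) (attachments L B'))
    (hc : ¬ Cross v n (attachments L B) (attachments L B')) : Avoid L B B' := by
  have hn := hv.three_le
  have hr : ∀ B : G.Subgraph, attachments L B ⊆ Set.range v := fun B z hz => hL.verts ▸ hz.1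
  rcases (attachments L B').eq_empty_or_nonempty with h0 | ⟨_, hz⟩
  · refine hv.avoid_of_subset_arc hL (s := 0) (t := n - 1) (by omega) (by omega) ?_ (by simp [h0])
    intro z hz
    obtain ⟨i, rfl, h1, h2⟩ := hv.exists_pos (hr B hz) 0
    exact mem_arc h1 (by omega)
  obtain ⟨s, rfl⟩ := hr B' hz
  have hpos : ∀ z ∈ attachments L B, ∃ i, v i = z ∧ s < i ∧ i < s + n := by
    intro z hz'
    obtain ⟨i, rfl, h1, h2⟩ := hv.exists_pos (hr B hz') s
    refine ⟨i, rfl, lt_of_le_of_ne h1 ?_, h2⟩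
    rintro rfl
    exact Set.disjoint_left.mp hd hz' hz
  rcases (attachments L B).eq_empty_or_nonempty with h0 | ⟨_, hz'⟩
  · refine hv.avoid_of_subset_arc hL (s := s) (t := s + 1) (by omega) (by omega) (by simp [h0]) ?_
    intro z hz
    obtain ⟨i, rfl, h1, h2⟩ := hv.exists_pos (hr B' hz) (s + 1)
    exact mem_arc h1 (by omega)
  -- the positions of the attachments of `B` between two occurrences of an attachment of `B'`
  set Q : ℤ → Prop := fun i => s < i ∧ i < s + n ∧ v i ∈ attachments L B with hQ
  have hne : ∃ i, Q i := by
    obtain ⟨i, rfl, h1, h2⟩ := hpos _ hz'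
    exact ⟨i, h1, h2, hz'⟩
  obtain ⟨m, hm, hm'⟩ := Int.exists_least_of_bdd ⟨s, fun z hz => hz.1.le⟩ hne
  obtain ⟨M, hM, hM'⟩ := Int.exists_greatest_of_bdd ⟨s + n, fun z hz => hz.2.1.le⟩ hne
  have hsub : ∀ z ∈ attachments L B, ∃ i, v i = z ∧ m ≤ i ∧ i ≤ M := by
    intro z hz
    obtain ⟨i, rfl, h1, h2⟩ := hpos z hz
    exact ⟨i, rfl, hm' i ⟨h1, h2, hz⟩, hM' i ⟨h1, h2, hz⟩⟩
  rcases (hm' M hM).eq_or_lt with rfl | hlt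
  · refine hv.avoid_of_subset_arc hL (s := m) (t := m + 1) (by omega) (by omega) ?_ ?_
    · intro z hz
      obtain ⟨i, rfl, h1, h2⟩ := hsub z hz
      exact mem_arc h1 (by omega)
    · intro z hz
      obtain ⟨i, rfl, h1, h2⟩ := hv.exists_pos (hr B' hz) (m + 1)
      exact mem_arc h1 (by omega)
  · refine hv.avoid_of_subset_arc hL (s := m) (t := M) hlt
      (by have := hm.1; have := hM.2.1; omega) ?_ ?_
    · intro z hz
      obtain ⟨i, rfl, h1, h2⟩ := hsub z hz
      exact mem_arc h1 (by omega)
    · intro z hz'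
      obtain ⟨i, rfl, h1, h2⟩ := hv.exists_pos (hr B' hz') m
      by_cases h3 : i < M
      · exfalso
        have h4 : m ≠ i := by
          rintro rfl
          exact Set.disjoint_left.mp hd hm.2.2 hz'
        exact hc ⟨m, i, M, s + n, by omega, h3, hM.2.1, by have := hm.1; omega, hm.2.2, hz',
          hM.2.2, by rwa [hv.periodic]⟩
      · exact mem_arc (by omega) (by omega)

lemma eq_or_eq_of_adj {L : G.Subgraph} (hL : RunsAlong v L) {j : ℤ} {b : V}
    (h : L.Adj (v j) b) : b = v (j + 1) ∨ b = v (j - 1) := by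
  obtain ⟨m, hm⟩ := (hL.adj_iff _ b).mp h
  have hn := hv.three_le
  rw [Sym2.eq_iff] at hm
  rcases hm with ⟨h1, rfl⟩ | ⟨rfl, h1⟩
  · obtain ⟨d, hd, h2, h3⟩ := exists_shift (by omega) hv.periodic m j
    rw [← hd m] at h1
    have := hv.inj _ _ h1 (by omega) (by omega)
    rw [← this, ← hd (m + 1), add_right_comm]
    exact .inl rfl
  · obtain ⟨d, hd, h2, h3⟩ := exists_shift (by omega) hv.periodic (m + 1) j
    rw [← hd (m + 1)] at h1
    have := hv.inj _ _ h1 (by omega) (by omega)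
    rw [← this, ← hd m, add_right_comm m 1 d, add_sub_cancel_right]
    exact .inr rfl

/-- A subwalk of the cycle that leaves out two cycle edges stays on one side of them. -/
lemma mem_arc_of_mem_support {L : G.Subgraph} (hL : RunsAlong v L) {x y : V} {p : G.Walk x y}
    (hp : p.toSubgraph ≤ L) {s t : ℤ}
    (hs : s(v (s - 1), v s) ∉ p.edges) (ht : s(v (t - 1), v t) ∉ p.edges) {a b : V}
    (ha : a ∈ p.support) (hb : b ∈ p.support) (ha' : a ∈ arc v s t) : b ∈ arc v s t := by
  have hstep : ∀ a b, s(a, b) ∈ p.edges → a ∈ arc v s t → b ∈ arc v s t := by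
    rintro _ b hab ⟨r, ⟨hr1, hr2⟩, rfl⟩
    rcases hv.eq_or_eq_of_adj hL (hp.2 (Walk.adj_toSubgraph_iff_mem_edges.mpr hab)) with rfl | rfl
    · refine mem_arc (by omega) (lt_of_le_of_ne (by omega) fun h => ht ?_)
      rwa [← h, add_sub_cancel_right]
    · refine mem_arc (Int.le_sub_one_iff.mpr (lt_of_le_of_ne hr1 fun h => hs ?_)) (by omega)
      rwa [h, Sym2.eq_swap]
  have hall : ∀ z ∈ p.support, z ∈ arc v s t ↔ x ∈ arc v s t := by
    clear hs ht ha hb ha' hp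
    induction p with
    | nil => simp
    | cons h p ih =>
      intro z hz
      rw [Walk.support_cons, List.mem_cons] at hz
      rcases hz with rfl | hz
      · rfl
      · rw [ih (fun a b hab => hstep a b (by simp [hab])) z hz]
        exact ⟨hstep _ _ (by simp [Sym2.eq_swap]), hstep _ _ (by simp)⟩
  rwa [hall b hb, ← hall a ha]

/-- If members of two sets alternate around the cycle, then of two edge-disjoint paths
making up the cycle, one covering each set, the first contains both cycle edges at a member
of the second set, which leaves no edge for the second path there. -/
lemma not_cross_of_avoid {L B B' : G.Subgraph} (hL : RunsAlong v L) (h : Avoid L B B') :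
    ¬ Cross v n (attachments L B) (attachments L B') := by
  obtain ⟨x, y, p, q, hp, hq, hpq, hu, h1, h2⟩ := h
  rintro ⟨i, j, k, l, hij, hjk, hkl, hln, hi, hj, hk, hl⟩
  have hpL : p.toSubgraph ≤ L := hu ▸ le_sup_left
  have hqL : q.toSubgraph ≤ L := hu ▸ le_sup_right
  have hmem : ∀ r, v r ∈ attachments L B' →
      ¬ (s(v (r - 1), v r) ∈ p.edges ∧ s(v r, v (r + 1)) ∈ p.edges) := by
    rintro r hr ⟨h3, h4⟩
    have hnil : ¬ q.Nil := by
      intro hq'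
      obtain rfl := hq'.eq
      rw [Walk.isPath_iff_nil.mp hp |>.eq_nil] at h3
      simp at h3
    obtain ⟨e, he, hre⟩ := (Walk.mem_support_iff_exists_mem_edges_of_not_nil hnil).mp
      ((Walk.mem_verts_toSubgraph q).mp (h2 hr))
    obtain ⟨b, rfl⟩ := hre
    have hqb := Walk.adj_toSubgraph_iff_mem_edges.mpr he
    refine Set.disjoint_left.mp hpq (?_ : s(v r, b) ∈ _) hqb
    rw [Subgraph.mem_edgeSet, Walk.adj_toSubgraph_iff_mem_edges]
    rcases hv.eq_or_eq_of_adj hL (hqL.2 hqb) with rfl | rfl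
    · exact h4
    · rwa [Sym2.eq_swap]
  have hcover : (∀ r, i ≤ r → r < k → s(v r, v (r + 1)) ∈ p.edges) ∨
      ∀ r, k ≤ r → r < i + n → s(v r, v (r + 1)) ∈ p.edges := by
    by_contra! hc
    obtain ⟨⟨r, hr1, hr2, hr3⟩, r', hr1', hr2', hr3'⟩ := hc
    have h3 := hv.mem_arc_of_mem_support hL hpL (s := r + 1) (t := r' + 1)
      (by rwa [add_sub_cancel_right]) (by rwa [add_sub_cancel_right])
      ((Walk.mem_verts_toSubgraph p).mp (h1 hk)) ((Walk.mem_verts_toSubgraph p).mp (h1 hi))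
      (mem_arc (by omega) (by omega))
    rw [← hv.periodic, hv.mem_arc_iff (by omega) (by omega) (by omega)] at h3
    omega
  rcases hcover with hc | hc
  · exact hmem j hj ⟨by simpa using hc (j - 1) (by omega) (by omega), hc j hij.le hjk⟩
  · exact hmem l hl ⟨by simpa using hc (l - 1) (by omega) (by omega), hc l hkl.le hln⟩

end IsLongestCyclicSeq

/-! ### Trees in bridges -/

section forest

variable {V : Type*} {F : SimpleGraph V}

/-- In a forest, the component of `x` that remains when an edge at `x` is deleted contains a
leaf of the forest: the last vertex of a longest path of this component starting at `x`. -/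
lemma exists_leaf_reachable [Finite V] (hF : F.IsAcyclic) {x y : V} (hxy : F.Adj x y) :
    ∃ a, (F.deleteEdges {s(x, y)}).Reachable x a ∧ (F.neighborSet a).ncard = 1 := by
  classical
  have := Fintype.ofFinite V
  set K := F.deleteEdges {s(x, y)} with hK
  have hKF : K ≤ F := deleteEdges_le _
  have hbr : ¬ K.Reachable x y := isBridge_iff.mp (isAcyclic_iff_forall_adj_isBridge.mp hF hxy)
  let P : ℕ → Prop := fun k => ∃ a, ∃ p : K.Walk x a, p.IsPath ∧ p.length = k
  have hP : P (Nat.findGreatest P (Fintype.card V)) :=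
    Nat.findGreatest_spec (P := P) (Nat.zero_le _) ⟨x, .nil, .nil, rfl⟩
  obtain ⟨a, p, hp, hl⟩ := hP
  have hend : ∀ c, K.Adj a c → c = p.penultimate := by
    intro c hc
    refine (hF.anti hKF).eq_penultimate_of_adj_end hp hc ?_
    by_contra hcp
    have h := (Walk.concat_isPath_iff hc).mpr ⟨hp, hcp⟩
    have h1 := Nat.le_findGreatest (P := P) h.length_lt.le ⟨c, _, h, rfl⟩
    rw [← hl, Walk.length_concat] at h1
    omega
  refine ⟨a, ⟨p⟩, Set.ncard_eq_one.mpr ?_⟩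
  by_cases hnil : p.Nil
  · obtain rfl := hnil.eq
    refine ⟨y, Set.ext fun c => ⟨fun hc => ?_, ?_⟩⟩
    · by_contra hcy
      have h1 : K.Adj x c := deleteEdges_adj.mpr ⟨hc, fun h =>
        hcy (Sym2.congr_right.mp h)⟩
      have h2 := hend c h1
      rw [(Walk.isPath_iff_nil.mp hp).eq_nil] at h2
      exact h1.ne h2.symm
    · rintro rfl
      exact hxy
  · refine ⟨p.penultimate, Set.ext fun c => ⟨fun hc => hend c ?_, ?_⟩⟩
    · refine deleteEdges_adj.mpr ⟨hc, fun hac => ?_⟩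
      rw [Set.mem_singleton_iff, Sym2.eq_iff] at hac
      rcases hac with ⟨rfl, -⟩ | ⟨rfl, -⟩
      · exact hnil (Walk.isPath_iff_nil.mp hp)
      · exact hbr ⟨p⟩
    · rintro rfl
      exact hKF (p.adj_penultimate hnil).symm

open Classical in
/-- The side of the edge `e` of the forest `F` that contains the first end of `e`. -/
noncomputable def edgeSide (F : SimpleGraph V) (e : Sym2 V) (z : V) : Bool :=
  decide ((F.deleteEdges {e}).Reachable e.out.1 z)

lemma mem_edges_of_edgeSide_ne {a b : V} (w : F.Walk a b) {e : Sym2 V}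
    (h : edgeSide F e a ≠ edgeSide F e b) : e ∈ w.edges := by
  refine w.mem_edges_of_not_reachable_deleteEdges fun hr => h ?_
  simp only [edgeSide, decide_eq_decide]
  exact ⟨fun h => h.trans hr, fun h => h.trans hr.symm⟩

lemma sum_sep_edgeSide_le (E : Finset (Sym2 V)) {a b : V} (w : F.Walk a b) :
    ∑ e ∈ E, sep (edgeSide F e) a b ≤ w.length := by
  classical
  calc ∑ e ∈ E, sep (edgeSide F e) a b
      ≤ ∑ e ∈ E, if e ∈ w.edges then 1 else 0 := by
        refine Finset.sum_le_sum fun e _ => ?_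
        unfold sep
        split_ifs with h1 h2 h2
        · exact Nat.zero_le _
        · exact le_rfl
        · exact le_rfl
        · exact absurd (mem_edges_of_edgeSide_ne w h1) h2
    _ = (E.filter (· ∈ w.edges)).card := (Finset.card_filter _ _).symm
    _ ≤ w.edges.toFinset.card := Finset.card_le_card fun e he => by
        simpa using (Finset.mem_filter.mp he).2
    _ ≤ w.length := (List.toFinset_card_le _).trans w.length_edges.le

/-- Every edge of a forest separates two leaves. -/
lemma exists_leaves_edgeSide_ne [Finite V] (hF : F.IsAcyclic) {e : Sym2 V} (he : e ∈ F.edgeSet) :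
    ∃ a b, (F.neighborSet a).ncard = 1 ∧ (F.neighborSet b).ncard = 1 ∧
      edgeSide F e a ≠ edgeSide F e b := by
  have hout : s(e.out.1, e.out.2) = e := e.out_eq
  have hadj : F.Adj e.out.1 e.out.2 := by rwa [← mem_edgeSet, hout]
  obtain ⟨a, ha, ha'⟩ := exists_leaf_reachable hF hadj
  obtain ⟨b, hb, hb'⟩ := exists_leaf_reachable hF hadj.symm
  have hbr := isBridge_iff.mp (isAcyclic_iff_forall_adj_isBridge.mp hF hadj)
  rw [Sym2.eq_swap] at hb
  rw [hout] at ha hb hbr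
  refine ⟨a, b, ha', hb', fun h => hbr ?_⟩
  simp only [edgeSide, decide_eq_decide] at h
  exact (h.mp ha).trans hb.symm

/-- The interior vertices of a path are not leaves. -/
lemma ncard_neighborSet_ne_one {a b z : V} {w : F.Walk a b} (hw : w.IsPath) (hz : z ∈ w.support)
    (hza : z ≠ a) (hzb : z ≠ b) : (F.neighborSet z).ncard ≠ 1 := by
  obtain ⟨k, rfl, hk⟩ := Walk.mem_support_iff_exists_getVert.mp hz
  have hk0 : k ≠ 0 := by
    rintro rfl
    simp at hza
  have hkl : k ≠ w.length := by
    rintro rfl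
    simp at hzb
  intro h
  obtain ⟨c, hc⟩ := Set.ncard_eq_one.mp h
  have h1 : w.getVert (k - 1) ∈ F.neighborSet (w.getVert k) := by
    have := w.adj_getVert_succ (i := k - 1) (by omega)
    rw [Nat.sub_add_cancel (by omega)] at this
    exact this.symm
  have h2 : w.getVert (k + 1) ∈ F.neighborSet (w.getVert k) := w.adj_getVert_succ (by omega)
  rw [hc, Set.mem_singleton_iff] at h1 h2
  have := hw.getVert_injOn (by simp only [Set.mem_ofPred_eq]; omega)
    (by simp only [Set.mem_ofPred_eq]; omega) (h1.trans h2.symm)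
  omega

end forest

section bridge

variable {V : Type*} {G : SimpleGraph V}

lemma isAcyclic_spanningCoe {T : G.Subgraph} (hT : T.coe.IsAcyclic) : T.spanningCoe.IsAcyclic := by
  rw [isAcyclic_iff_forall_adj_isBridge] at hT ⊢
  intro x y hxy
  rw [Subgraph.spanningCoe_adj] at hxy
  rw [isBridge_iff]
  have h := isBridge_iff.mp (hT (v := ⟨x, hxy.fst_mem⟩) (w := ⟨y, hxy.snd_mem⟩) hxy)
  rintro ⟨w⟩
  have key : ∀ a b (w : (T.spanningCoe.deleteEdges {s(x, y)}).Walk a b) (ha : a ∈ T.verts)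
      (hb : b ∈ T.verts), (T.coe.deleteEdges
        {s((⟨x, hxy.fst_mem⟩ : T.verts), ⟨y, hxy.snd_mem⟩)}).Reachable ⟨a, ha⟩ ⟨b, hb⟩ := by
    intro a b w ha hb
    induction w with
    | nil => exact .refl _
    | @cons a c b hac w ih =>
      rw [deleteEdges_adj, Subgraph.spanningCoe_adj] at hac
      refine (Adj.reachable (deleteEdges_adj.mpr ⟨?_, ?_⟩)).trans (ih hac.1.snd_mem hb)
      · exact hac.1
      · simpa [Subtype.ext_iff] using hac.2
  exact h (key x y w _ _)

lemma hasPath_componentVerts {H : G.Subgraph} {D : (G.induce H.vertsᶜ).ConnectedComponent}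
    {d d' : V} (hd : d ∈ componentVerts H D) (hd' : d' ∈ componentVerts H D) :
    HasPath G (componentVerts H D) d d' 1 := by
  classical
  obtain ⟨d, hd, rfl⟩ := hd
  obtain ⟨d', hd', rfl⟩ := hd'
  rw [ConnectedComponent.mem_supp_iff] at hd hd'
  obtain ⟨w, hw⟩ := (ConnectedComponent.exact (hd.trans hd'.symm)).exists_isPath
  let f : G.induce H.vertsᶜ →g G := (Embedding.induce _).toHom
  have hs : (w.map f).support = w.support.map f := Walk.support_map f w
  refine ⟨w.map f, hw.map Subtype.val_injective, fun z hz => ?_, by simp⟩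
  obtain ⟨z, hz', rfl⟩ := List.mem_map.mp (show z ∈ w.support.map f by rw [← hs]; exact hz)
  refine ⟨z, ?_, rfl⟩
  rw [ConnectedComponent.mem_supp_iff, ← hd]
  exact ConnectedComponent.sound (w.takeUntil z hz').reachable.symm

/-- Two attachments of a bridge are joined by a path through the bridge. -/
lemma exists_path_through {H B : G.Subgraph} (hB : IsBridgeOf H B) {a b : V}
    (ha : a ∈ attachments H B) (hb : b ∈ attachments H B) (hab : a ≠ b) :
    ∃ w : G.Walk a b, w.IsPath ∧ ∀ z ∈ w.support, z = a ∨ z = b ∨ z ∈ B.verts \ H.verts := by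
  rcases hB with ⟨x, y, hxy, -, -, -, rfl⟩ | ⟨D, rfl⟩
  · have hadj : G.Adj a b := by
      rcases ha.2 with rfl | rfl <;> rcases hb.2 with rfl | rfl
      · exact absurd rfl hab
      · exact hxy
      · exact hxy.symm
      · exact absurd rfl hab
    refine ⟨.cons hadj .nil, by simp [hab], fun z hz => ?_⟩
    simp only [Walk.support_cons, Walk.support_nil, List.mem_cons, List.not_mem_nil,
      or_false] at hz
    tauto
  · have hD : componentVerts H D ⊆ (componentBridge H D).verts \ H.verts := by
      rintro _ ⟨z, hz, rfl⟩
      exact ⟨.inl ⟨z, hz, rfl⟩, z.2⟩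
    have hnb : ∀ a ∈ attachments H (componentBridge H D), ∃ d ∈ componentVerts H D, G.Adj d a := by
      rintro a ⟨ha, ha' | ha'⟩
      · exact absurd ha (hD ha').2
      · exact ha'.2
    obtain ⟨d, hd, hda⟩ := hnb a ha
    obtain ⟨d', hd', hdb⟩ := hnb b hb
    have haD : a ∉ componentVerts H D := fun h => (hD h).2 ha.1
    have hbD : b ∉ componentVerts H D := fun h => (hD h).2 hb.1
    obtain ⟨w, h1, h2, -⟩ := ((HasPath.refl (Set.mem_singleton a)).append hda.symm
      (hasPath_componentVerts hd hd') (by simpa using haD)).append hdb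
      (HasPath.refl (Set.mem_singleton b)) (by simpa using ⟨hab.symm, hbD⟩)
    refine ⟨w, h1, fun z hz => ?_⟩
    rcases h2 z hz with (hz | hz) | hz
    · exact .inl hz
    · exact .inr (.inr (hD hz))
    · exact .inr (.inl hz)

/-- The length of a bridge is the number of edges of a tree `T` in it whose leaves are the
attachments, or zero if there is no such tree. Every edge of `T` separates two attachments, and the
path of `T` between two attachments contains all edges separating them. -/
lemma exists_cuts [Finite V] {H B : G.Subgraph} (hB : IsBridgeOf H B) :
    ∃ (E : Finset (Sym2 V)) (φ : Sym2 V → V → Bool), E.card = bridgeLength H B ∧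
      (∀ a ∈ attachments H B, ∀ b ∈ attachments H B, a ≠ b → ∃ w : G.Walk a b, w.IsPath ∧
        (∀ z ∈ w.support, z = a ∨ z = b ∨ z ∈ B.verts \ H.verts) ∧
        ∑ e ∈ E, sep (φ e) a b ≤ w.length) ∧
      ∀ e ∈ E, ∃ a ∈ attachments H B, ∃ b ∈ attachments H B, φ e a ≠ φ e b := by
  classical
  rcases (attachmentTreeSizes H B).eq_empty_or_nonempty with h0 | hne
  · refine ⟨∅, fun _ _ => false, by simp [bridgeLength, h0], fun a ha b hb hab => ?_, by simp⟩
    obtain ⟨w, h1, h2⟩ := exists_path_through hB ha hb hab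
    exact ⟨w, h1, h2, by simp⟩
  · obtain ⟨T, hTB, hT, hleaves, hcard⟩ := Nat.sSup_mem hne (bddAbove_attachmentTreeSizes H B)
    have hleaf : ∀ a, (T.spanningCoe.neighborSet a).ncard = 1 ↔ a ∈ attachments H B := by
      intro a
      rw [← hleaves]
      refine ⟨fun h => ⟨?_, h⟩, fun h => h.2⟩
      obtain ⟨c, hc⟩ := Set.ncard_eq_one.mp h
      exact T.edge_vert (show c ∈ T.spanningCoe.neighborSet a by rw [hc]; rfl)
    have hacyc := isAcyclic_spanningCoe hT.isAcyclic
    refine ⟨(Set.toFinite T.edgeSet).toFinset, edgeSide T.spanningCoe, ?_, ?_, ?_⟩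
    · rw [← Set.ncard_eq_toFinset_card _ (Set.toFinite _), hcard, bridgeLength]
    · intro a ha b hb hab
      rw [← hleaves] at ha hb
      have hr : T.spanningCoe.Reachable a b :=
        (hT.connected.preconnected ⟨a, ha.1⟩ ⟨b, hb.1⟩).map T.coeEmbeddingSpanningCoe.toHom
      obtain ⟨w, hw⟩ := hr.exists_isPath
      refine ⟨w.mapLe T.spanningCoe_le, by simpa using hw, fun z hz => ?_, ?_⟩
      · rw [Walk.support_mapLe_eq_support] at hz
        by_cases hza : z = a
        · exact .inl hza
        by_cases hzb : z = b
        · exact .inr (.inl hzb)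
        refine .inr (.inr ?_)
        have hzT : z ∈ T.verts := by
          obtain ⟨e, he, hze⟩ := (Walk.mem_support_iff_exists_mem_edges_of_not_nil
            (fun h => hab h.eq)).mp hz
          obtain ⟨c, rfl⟩ := hze
          exact T.edge_vert (w.adj_of_mem_edges he)
        exact ⟨hTB.1 hzT, fun hzH => ncard_neighborSet_ne_one hw hz hza hzb
          ((hleaf z).mpr ⟨hzH, hTB.1 hzT⟩)⟩
      · rw [Walk.length_mapLe]
        exact sum_sep_edgeSide_le _ w
    · intro e he
      obtain ⟨a, b, ha, hb, hab⟩ := exists_leaves_edgeSide_ne hacyc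
        (show e ∈ T.spanningCoe.edgeSet by simpa using he)
      exact ⟨a, (hleaf a).mp ha, b, (hleaf b).mp hb, hab⟩

end bridge

/-! ### Bridges of a longest cycle -/

variable {V : Type*} {G : SimpleGraph V} {u : V}

lemma IsBridgeOf.verts_nonempty {H B : G.Subgraph} (hB : IsBridgeOf H B) : B.verts.Nonempty := by
  rcases hB with ⟨x, y, hxy, -, -, -, rfl⟩ | ⟨D, rfl⟩
  · exact ⟨x, .inl rfl⟩
  · obtain ⟨d, hd⟩ := D.nonempty_supp
    exact ⟨d, .inl ⟨d, hd, rfl⟩⟩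

/-- Pairwise disjoint bridges of a longest cycle whose overlap graph is a tree form a
`BridgeSystem`, as disjoint bridges overlap if and only if their attachments cross. -/
lemma exists_bridgeSystem [Finite V] {L : G.Walk u u} (hL : IsLongestCycle L)
    {X : Set (BridgeOf L.toSubgraph)}
    (hdisj : ∀ x ∈ X, ∀ y ∈ X, x ≠ y → Disjoint x.1.verts y.1.verts)
    (htree : ((overlapGraph L.toSubgraph).induce X).IsTree) :
    ∃ S : BridgeSystem G X, S.n = L.length ∧
      ∀ x, (S.cuts x).card = bridgeLength L.toSubgraph x.1.1 := by
  have hv := isLongestCyclicSeq_cycleSeq hL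
  have hr : RunsAlong (cycleSeq L) L.toSubgraph :=
    runsAlong_cycleSeq (by have := hv.three_le; omega)
  choose E φ hE hjump hside using fun x : X => exists_cuts x.1.2
  have hd : ∀ x y : X, x ≠ y → Disjoint x.1.1.verts y.1.1.verts := fun x y hxy =>
    hdisj x.1 x.2 y.1 y.2 fun h => hxy (Subtype.ext h)
  have hatt : ∀ x y : X, x ≠ y →
      Disjoint (attachments L.toSubgraph x.1.1) (attachments L.toSubgraph y.1.1) := fun x y hxy =>
    (hd x y hxy).mono Set.inter_subset_right Set.inter_subset_right
  exact ⟨{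
    v := cycleSeq L
    n := L.length
    cyc := hv
    att := fun x => attachments L.toSubgraph x.1.1
    inner := fun x => x.1.1.verts \ L.toSubgraph.verts
    cuts := E
    side := φ
    T := (overlapGraph L.toSubgraph).induce X
    att_subset := fun x => hr.verts ▸ Set.inter_subset_left
    att_disjoint := hatt
    inner_disjoint := fun x y hxy => (hd x y hxy).mono Set.sdiff_subset Set.sdiff_subset
    inner_off := fun x => hr.verts ▸ Set.disjoint_sdiff_left
    jump := hjump
    side_ne := hside
    tree := htree
    adj_iff := fun x y hxy => by
      have hxy' : x.1 ≠ y.1 := fun h => hxy (Subtype.ext h)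
      constructor
      · intro h
        by_contra hc
        exact h.2 (hv.avoid_of_not_cross hr (hatt x y hxy) hc)
      · exact fun h => ⟨hxy', fun h' => hv.not_cross_of_avoid hr h' h⟩ }, rfl, hE⟩

end BridgesOfCycles

theorem theorem3 {V : Type*} [Finite V] (G : SimpleGraph V)
    (hG : BridgesOfCycles.IsTwoConnected G)
    {u : V} (L : G.Walk u u) (hL : BridgesOfCycles.IsLongestCycle L)
    (k : ℕ) (B : Fin k → BridgesOfCycles.BridgeOf L.toSubgraph)
    (hdisj : ∀ i j : Fin k, i ≠ j → Disjoint (B i).1.verts (B j).1.verts)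
    (htree : ((BridgesOfCycles.overlapGraph L.toSubgraph).induce (Set.range B)).IsTree) :
    ∑ i, BridgesOfCycles.bridgeLength L.toSubgraph (B i).1 ≤ L.toSubgraph.edgeSet.ncard / 2 := by
  have hinj : Function.Injective B := by
    intro i j hij
    by_contra h
    obtain ⟨z, hz⟩ := (B i).2.verts_nonempty
    exact Set.disjoint_left.mp (hdisj i j h) hz (hij ▸ hz)
  obtain ⟨S, hn, hcard⟩ := BridgesOfCycles.exists_bridgeSystem hL (by
    rintro _ ⟨i, rfl⟩ _ ⟨j, rfl⟩ hij
    exact hdisj i j fun h => hij (h ▸ rfl)) htree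
  have := Fintype.ofFinite (Set.range B)
  have h := S.two_mul_sum_card_le
  rw [← Equiv.sum_comp (Equiv.ofInjective B hinj), hn] at h
  simp only [hcard, Equiv.ofInjective_apply] at h
  rw [BridgesOfCycles.ncard_edgeSet_toSubgraph hL.1, Nat.le_div_iff_mul_le two_pos, mul_comm]
  exact_mod_cast h
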